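/- Let $m\in\mathbb N$, let $-\infty\le a<b<\infty$, let $(K_1,d_1),\dots,(K_m,d_m)$ be complete, locally compact length metric spaces (i.e. $d_i(x,y)$ is always the infimum of the lengths of continuous paths from $x$ to $y$), and let $f_1,\dots,f_m:(a,b)\to(0,\infty)$ be continuously differentiable functions such that for every $i$ we have $\int_c^b f_i(t)^{-1/2}\,dt<\infty$ for some (hence any) $c\in(a,b)$. Put $K=K_1\times\dots\times K_m$, $X=(a,b)\times K$ and $\overline X=(a,b]\times K$, with the product topologies. On $X$ and on $\overline X$ define $(t,x)\ll_0(s,y)$ to mean that $t<s$ and there is a good path from $(t,x)$ to $(s,y)$, i.e. a continuous path $c:[t,s]\to X$ (resp. $\overline X$) from $(t,x)$ to $(s,y)$ whose first component is $c_0(u)=u$ and such that each $r\in(t,s)$ has a neighbourhood $U$ and constants $k_i\ge0$ with $\sum_{i=1}^m k_i^2<1$ for which the $K_i$-component of $c|_U$ is $k_i$-Lipschitz with respect to $\sqrt{f_i(r)}\,d_i$, for all $i$. For a set $Y$ with a relation $\ll$, let $I^-(A)=\{x: x\ll y\text{ for some }y\in A\}$, $I^\pm(p)$ the chronological future/past of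 $p$, and $x\le y$ iff $I^+(y)\subset I^+(x)$ and $I^-(x)\subset I^-(y)$; a set $A$ is past iff $A=I^-(A)$, and $IP(Y)$ is the set of nonempty past sets that are not the union of two past proper subsets. On $IP(Y)$ let $A\ll_{BS}B$ iff $B\cap\bigcap_{r\in A}I^+(r)\neq\emptyset$. For a sequence $\alpha$ in $Y$ let $\liminf^-\alpha=\bigcup_n\{z: z\le \alpha(k)\ \forall k\ge n\}$, $\limsup^-\alpha=\bigcup_j\{z: z\le \alpha(j(n))\ \forall n\}$ (union over strictly increasing $j:\mathbb N\to\mathbb N$), and $L_+(\alpha)=\{v\in Y: I^-(\liminf^-\alpha)=I^-(\limsup^-\alpha)=I^-(v)\}$; the topology $\tau_+$ of $(Y,\ll)$ is the one whose closed sets are the $S\subset Y$ with $L_+(\alpha)\subset S$ for every sequence $\alpha$ in $S$. Then $(IP(X),\ll_{BS},\tau_+)$, where $IP(X)$ is formed with respect to $\ll_0$ and $\tau_+$ is the topology of $(IP(X),\ll_{BS})$, is chronologically homeomorphic to $(\overline X,\ll_0)$ with the product topology: there is a homeomorphism $\Phi:(IP(X),\tau_+)\to\overline X$ such that $A\ll_{BS}B\Leftrightarrow\Phi(A)\ll_0\Phi(B)$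 for all $A,B\in IP(X)$. -/

import Mathlib

open Set Topology
open scoped NNReal ENNReal

namespace WarpedChron

universe u

/- Notions for a set `Y` with a chronological relation `R` (where `R x y` is read `x ≪ y`). -/

section Chronology

variable {Y : Type u} (R : Y → Y → Prop)

/-- The chronological past `I⁻(A)` of a subset `A`. -/
def chronPast (A : Set Y) : Set Y := {x | ∃ y ∈ A, R x y}

/-- The joint chronological future of `A`: the intersection of all `I⁺(r)`, `r ∈ A`. -/
def jointChronFuture (A : Set Y) : Set Y := {z | ∀ r ∈ A, R r z}

/-- The causal relation induced by `≪`: `x ≤ y` iff `I⁺(y) ⊆ I⁺(x)` and `I⁻(x) ⊆ I⁻(y)`. -/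
def CausalRel (x y : Y) : Prop := {z | R y z} ⊆ {z | R x z} ∧ {z | R z x} ⊆ {z | R z y}

/-- The joint causal past of `A`: the intersection of all `J⁻(r)`, `r ∈ A`. -/
def jointCausalPast (A : Set Y) : Set Y := {z | ∀ r ∈ A, CausalRel R z r}

/-- `A` is a past set: `A = I⁻(A)`. -/
def IsPast (A : Set Y) : Prop := A = chronPast R A

/-- `A` is an indecomposable past set: nonempty, past, and not the union of two past
proper subsets. -/
def IsIndecomposablePast (A : Set Y) : Prop :=
  A.Nonempty ∧ IsPast R A ∧
    ¬ ∃ B C : Set Y, IsPast R B ∧ IsPast R C ∧ B ⊂ A ∧ C ⊂ A ∧ A = B ∪ C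

/-- The set `IP` of all indecomposable past sets. -/
def IP : Type u := {A : Set Y // IsIndecomposablePast R A}

/-- The Budic-Sachs relation: `A ≪ B` iff some point of `B` lies in the joint chronological
future of `A`. -/
def BudicSachs (A B : IP R) : Prop := (jointChronFuture R A.1 ∩ B.1).Nonempty

/-- `liminf⁻ a`, the union over `n` of the joint causal pasts of the tails `{a m | n ≤ m}`. -/
def liminfPast (a : ℕ → Y) : Set Y := ⋃ n : ℕ, jointCausalPast R (a '' {m | n ≤ m})

/-- `limsup⁻ a`, the union of the joint causal pasts of all subsequences of `a`. -/
def limsupPast (a : ℕ → Y) : Set Y :=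
  ⋃ (j : ℕ → ℕ) (_ : StrictMono j), jointCausalPast R (range (a ∘ j))

/-- The limit operator `L₊`. -/
def limitOp (a : ℕ → Y) : Set Y :=
  {v | chronPast R (liminfPast R a) = chronPast R (limsupPast R a) ∧
    chronPast R (limsupPast R a) = chronPast R {v}}

theorem chronPast_mono {A B : Set Y} (h : A ⊆ B) : chronPast R A ⊆ chronPast R B :=
  fun _ ⟨y, hy, hxy⟩ => ⟨y, h hy, hxy⟩

theorem liminfPast_subset_limsupPast (a : ℕ → Y) : liminfPast R a ⊆ limsupPast R a := by
  intro x hx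
  obtain ⟨n, hn⟩ := mem_iUnion.1 hx
  refine mem_iUnion₂.2 ⟨fun k => n + k, fun p q h => Nat.add_lt_add_left h n, ?_⟩
  rintro _ ⟨k, rfl⟩
  exact hn _ ⟨n + k, Nat.le_add_right n k, rfl⟩

theorem liminfPast_subset_comp (a : ℕ → Y) {j : ℕ → ℕ} (hj : StrictMono j) :
    liminfPast R a ⊆ liminfPast R (a ∘ j) := by
  intro x hx
  obtain ⟨n, hn⟩ := mem_iUnion.1 hx
  refine mem_iUnion.2 ⟨n, ?_⟩
  rintro _ ⟨k, hk, rfl⟩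
  exact hn _ ⟨j k, le_trans hk (hj.id_le k), rfl⟩

theorem limsupPast_comp_subset (a : ℕ → Y) {j : ℕ → ℕ} (hj : StrictMono j) :
    limsupPast R (a ∘ j) ⊆ limsupPast R a := by
  intro x hx
  obtain ⟨k, hk, hx⟩ := mem_iUnion₂.1 hx
  exact mem_iUnion₂.2 ⟨j ∘ k, hj.comp hk, hx⟩

/-- A limit of a sequence is a limit of each of its subsequences. -/
theorem limitOp_subset_comp (a : ℕ → Y) {j : ℕ → ℕ} (hj : StrictMono j) :
    limitOp R a ⊆ limitOp R (a ∘ j) := by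
  rintro v ⟨h₁, h₂⟩
  have e₁ := chronPast_mono R (liminfPast_subset_comp R a hj)
  have e₂ := chronPast_mono R (liminfPast_subset_limsupPast R (a ∘ j))
  have e₃ := chronPast_mono R (limsupPast_comp_subset R a hj)
  have h₃ : chronPast R (limsupPast R (a ∘ j)) = chronPast R (limsupPast R a) :=
    Subset.antisymm e₃ (h₁ ▸ e₁.trans e₂)
  exact ⟨Subset.antisymm e₂ (h₃ ▸ h₁ ▸ e₁), h₃.trans h₂⟩

/-- The topology `τ₊`: a set `S` is closed iff `L₊(a) ⊆ S` for every sequence `a` in `S`. -/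
abbrev tauPlus : TopologicalSpace Y :=
  TopologicalSpace.ofClosed {S : Set Y | ∀ a : ℕ → Y, (∀ n, a n ∈ S) → limitOp R a ⊆ S}
    (fun _ h => (h 0).elim)
    (fun _ hT a ha _ hv S hS => hT hS a (fun n => ha n S hS) hv)
    (by
      intro A hA B hB a ha v hv
      by_cases h : ∃ᶠ n in Filter.atTop, a n ∈ A
      · obtain ⟨j, hj, hjA⟩ := Filter.extraction_of_frequently_atTop h
        exact Or.inl (hA _ hjA (limitOp_subset_comp R a hj hv))
      · have h' : ∃ᶠ n in Filter.atTop, a n ∈ B :=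
          ((Filter.not_frequently.1 h).mono fun n hn => (ha n).resolve_left hn).frequently
        obtain ⟨j, hj, hjB⟩ := Filter.extraction_of_frequently_atTop h'
        exact Or.inr (hB _ hjB (limitOp_subset_comp R a hj hv)))

end Chronology

/-- `(Y, R, τ)` and `(Z, S, σ)` are chronologically homeomorphic: there is a homeomorphism
that preserves and reflects the chronological relations. -/
def ChronHomeomorphic {Y Z : Type*} (R : Y → Y → Prop) (τ : TopologicalSpace Y)
    (S : Z → Z → Prop) (σ : TopologicalSpace Z) : Prop :=
  ∃ Φ : Y ≃ Z, @IsHomeomorph Y Z τ σ Φ ∧ ∀ x y, R x y ↔ S (Φ x) (Φ y)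

/-- `K` is a length space: the distance of two points is the infimum of the lengths of the
continuous paths between them. -/
def IsLengthSpace (K : Type*) [MetricSpace K] : Prop :=
  ∀ x y : K, edist x y = ⨅ γ : Path x y, eVariationOn γ univ

/-- The real interval `(a; b)`, where `a = -∞` is allowed. -/
def openInterval (a : EReal) (b : ℝ) : Set ℝ := {t | a < (t : EReal) ∧ t < b}

/-- The real interval `(a; b]`, where `a = -∞` is allowed. -/
def halfOpenInterval (a : EReal) (b : ℝ) : Set ℝ := {t | a < (t : EReal) ∧ t ≤ b}

section Warped

variable {m : ℕ}

/-- The space `J × K₁ × ⋯ × Kₘ`. -/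
abbrev Warped (J : Set ℝ) (K : Fin m → Type u) : Type u := J × ((i : Fin m) → K i)

variable {J : Set ℝ} {K : Fin m → Type u} [∀ i, MetricSpace (K i)]

/-- `c`, restricted to `[t; s]`, is a good path from `p = (t, x)` to `q = (s, y)`, where `t < s`:
it is continuous, its `J`-component at the parameter `u` is `u`, and each `r ∈ (t; s)` has a
neighbourhood `U` on which each `Kᵢ`-component is `kᵢ`-Lipschitz with respect to the metric
`√(fᵢ(r)) dᵢ`, with `∑ kᵢ² < 1`. Only the values of the `fᵢ` on the open interval `(t; s)`
enter. -/
structure IsGoodPath (f : Fin m → ℝ → ℝ) (p q : Warped J K) (c : ℝ → Warped J K) : Prop where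
  lt : (p.1 : ℝ) < q.1
  continuousOn : ContinuousOn c (Icc (p.1 : ℝ) q.1)
  source : c p.1 = p
  target : c q.1 = q
  time : ∀ u ∈ Icc (p.1 : ℝ) q.1, ((c u).1 : ℝ) = u
  lipschitz : ∀ r ∈ Ioo (p.1 : ℝ) q.1, ∃ U ∈ 𝓝 r, ∃ k : Fin m → ℝ≥0,
    (∑ i, k i ^ 2 < 1) ∧
    ∀ i, ∀ u ∈ U ∩ Icc (p.1 : ℝ) q.1, ∀ v ∈ U ∩ Icc (p.1 : ℝ) q.1,
      √(f i r) * dist ((c u).2 i) ((c v).2 i) ≤ k i * |u - v|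

/-- The chronology `≪₀`: there is a good path from `p` to `q`. -/
def goodChron (J : Set ℝ) (K : Fin m → Type u) [∀ i, MetricSpace (K i)] (f : Fin m → ℝ → ℝ)
    (p q : Warped J K) : Prop :=
  ∃ c : ℝ → Warped J K, IsGoodPath f p q c

end Warped

end WarpedChron

/-! Put `φᵢ = fᵢ^(-1/2)`, the largest speed in the factor `Kᵢ`. The proof replaces paths by
inequalities between support functions. In a good path the vector of speeds, measured by the `fᵢ`,
has Euclidean norm less than `1`, so Cauchy-Schwarz bounds `∑ |lᵢ| dᵢ(xᵢ, yᵢ)` by `∫ ‖(lᵢ φᵢ(r))ᵢ‖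
dr` for every `l`, with a margin `ε ∑ |lᵢ|` that is uniform in `l`. Conversely, the displacements
produced by controls of norm less than `1` form a convex set with this support function. By
Hahn-Banach the inequalities with margin therefore yield a control, and running along almost
shortest curves of the factors at the speeds it prescribes gives a good path. This is
`goodChron_iff_timelike`, which rests on `IsGoodPath.timelike` and `Timelike.exists_isGoodPath`.

The relation `Timelike` makes sense up to the time `b` because the `φᵢ` are integrable there. It is
open and transitive; its version without margin, `Causal`, is closed and antisymmetric, and
composing the two gives `Timelike` again. Consequently points of `(a; b] × K` are determined by
their pasts in `(a; b) × K`. An indecomposable past set is directed; integrability and completeness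
make it converge to a point, whose past it is (`exists_eq_innerPast`). The Budic-Sachs relation then
corresponds to `Timelike`.

For the topology, a convergent sequence has its limit in `L₊`, and a point of `L₊` is the limit of a
subsequence, because the factors are proper by Hopf-Rinow-Cohn-Vossen. So `τ₊` and the product
topology have the same closed sets. -/

namespace WarpedChron

/-! ### Length spaces: almost shortest curves and properness -/

section LengthSpace

variable {K : Type*} [MetricSpace K]

/-- A chord is no longer than the arc above it, and arc lengths of adjacent pieces add up. This is
what parametrisation by arc length needs. -/
theorem dist_add_eVariationOn_Iic_le {x y : K} (γ : Path x y)
    (h : eVariationOn γ univ ≠ ⊤) {u v : unitInterval} (huv : u ≤ v) :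
    (eVariationOn γ (Iic u)).toReal + dist (γ u) (γ v) ≤ (eVariationOn γ (Iic v)).toReal := by
  have hfin : ∀ s : Set unitInterval, eVariationOn γ s ≠ ⊤ := fun s =>
    ne_top_of_le_ne_top h (eVariationOn.mono γ (subset_univ s))
  have h1 : eVariationOn γ (Iic u) + eVariationOn γ (Icc u v) ≤ eVariationOn γ (Iic v) := by
    refine (eVariationOn.add_le_union γ fun p hp q hq => le_trans hp hq.1).trans
      (eVariationOn.mono γ ?_)
    rintro p (hp | hp)
    · exact le_trans hp huv
    · exact hp.2
  have h2 : edist (γ u) (γ v) ≤ eVariationOn γ (Icc u v) :=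
    eVariationOn.edist_le γ (left_mem_Icc.2 huv) (right_mem_Icc.2 huv)
  have h3 := ENNReal.toReal_mono (hfin _) ((add_le_add_right h2 _).trans h1)
  rwa [ENNReal.toReal_add (hfin _) (edist_ne_top _ _), edist_dist,
    ENNReal.toReal_ofReal dist_nonneg] at h3

/-- In a length space, points at distance less than `L` are joined by a `1`-Lipschitz curve
with parameter interval `[0; L]`. -/
theorem IsLengthSpace.exists_lipschitz (hK : IsLengthSpace K) {x y : K} {L : ℝ}
    (hL : dist x y < L) :
    ∃ σ : ℝ → K, LipschitzWith 1 σ ∧ σ 0 = x ∧ σ L = y := by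
  have hlt : ⨅ γ : Path x y, eVariationOn γ univ < ENNReal.ofReal L := by
    rw [← hK x y, edist_dist]
    exact (ENNReal.ofReal_lt_ofReal_iff (dist_nonneg.trans_lt hL)).2 hL
  obtain ⟨γ, hγ⟩ := iInf_lt_iff.1 hlt
  have hfin : eVariationOn γ univ ≠ ⊤ := ne_top_of_lt hγ
  set V : unitInterval → ℝ := fun u => (eVariationOn γ (Iic u)).toReal
  have key : ∀ u v, u ≤ v → V u + dist (γ u) (γ v) ≤ V v :=
    fun u v huv => dist_add_eVariationOn_Iic_le γ hfin huv
  have hmono : Monotone V := fun u v huv => by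
    have := key u v huv
    linarith [dist_nonneg (x := γ u) (y := γ v)]
  have hV0 : ∀ u, 0 ≤ V u := fun u => ENNReal.toReal_nonneg
  -- A generalised inverse of the arc length `V`. It may jump where `γ` is constant, but `γ ∘ θ`
  -- does not notice: between `θ s` and `θ s'` the values of `V` lie in `(s; s']`, which bounds the
  -- chords there, and continuity of `γ` extends the bound to the endpoints.
  set θ : ℝ → unitInterval := fun s => sSup {u | V u ≤ s}
  have hθmono : Monotone θ := fun s s' hs => sSup_le_sSup fun u hu => le_trans hu hs
  have hgt : ∀ s u, θ s < u → s < V u := fun s u hu => by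
    by_contra hc
    exact absurd (le_sSup (show u ∈ {u | V u ≤ s} from not_lt.1 hc)) (not_le.2 hu)
  have hlt : ∀ s u, u < θ s → V u ≤ s := fun s u hu => by
    obtain ⟨w, hw, huw⟩ := lt_sSup_iff.1 hu
    exact (hmono huw.le).trans hw
  have hdist : ∀ s s', s ≤ s' → dist (γ (θ s)) (γ (θ s')) ≤ s' - s := by
    intro s s' hs
    rcases (hθmono hs).eq_or_lt with he | hlt'
    · rw [he, dist_self]; linarith
    have h1 : ∀ u ∈ Ioo (θ s) (θ s'), ∀ v ∈ Ioo (θ s) (θ s'), dist (γ u) (γ v) ≤ s' - s := by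
      have h0 : ∀ u ∈ Ioo (θ s) (θ s'), ∀ v ∈ Ioo (θ s) (θ s'), u ≤ v →
          dist (γ u) (γ v) ≤ s' - s := fun u hu v hv huv => by
        linarith [key u v huv, hgt s u hu.1, hlt s' v hv.2]
      intro u hu v hv
      rcases le_total u v with h | h
      · exact h0 u hu v hv h
      · rw [dist_comm]; exact h0 v hv u hu h
    have h2 : ∀ u ∈ Icc (θ s) (θ s'), ∀ v ∈ Ioo (θ s) (θ s'), dist (γ u) (γ v) ≤ s' - s := by
      intro u hu v hv
      rw [← closure_Ioo hlt'.ne] at hu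
      exact closure_minimal (fun w hw => h1 w hw v hv)
        (isClosed_le (f := fun w => dist (γ w) (γ v)) (by fun_prop) continuous_const) hu
    have h3 := closure_minimal (fun w hw => h2 (θ s) ⟨le_rfl, hlt'.le⟩ w hw)
        (isClosed_le (f := fun w => dist (γ (θ s)) (γ w)) (g := fun _ => s' - s)
          (by fun_prop) continuous_const)
    rw [closure_Ioo hlt'.ne] at h3
    exact h3 ⟨hlt'.le, le_rfl⟩
  refine ⟨fun s => γ (θ s), LipschitzWith.of_dist_le_mul fun s s' => ?_, ?_, ?_⟩
  · rw [NNReal.coe_one, one_mul, Real.dist_eq]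
    rcases le_total s s' with h | h
    · exact (hdist s s' h).trans (by rw [abs_sub_comm]; exact le_abs_self _)
    · rw [dist_comm]; exact (hdist s' s h).trans (le_abs_self _)
  · -- the points before `θ 0` lie on the constant part of the path
    have h0 : γ 0 = x := γ.source
    rcases (show (0 : unitInterval) ≤ θ 0 from unitInterval.nonneg').eq_or_lt with he | hpos
    · show γ (θ 0) = x
      rw [← he, h0]
    have h1 : ∀ u ∈ Ioo 0 (θ 0), γ u = x := fun u hu => by
      have := key 0 u hu.1.le
      have h2 := hlt 0 u hu.2
      rw [h0] at this
      exact (dist_le_zero.1 (by linarith [hV0 0])).symm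
    have h3 := closure_minimal (s := Ioo 0 (θ 0)) (t := {u | γ u = x}) h1
      (isClosed_eq (by fun_prop) continuous_const)
    rw [closure_Ioo hpos.ne] at h3
    exact h3 ⟨hpos.le, le_rfl⟩
  · have h1 : V 1 ≤ L := by
      refine ENNReal.toReal_le_of_le_ofReal (dist_nonneg.trans hL.le) ?_
      exact (eVariationOn.mono γ (subset_univ _)).trans hγ.le
    have h2 : θ L = 1 := le_antisymm unitInterval.le_one' (le_sSup h1)
    show γ (θ L) = y
    rw [h2, γ.target]

theorem IsLengthSpace.exists_dist_le (hK : IsLengthSpace K) {x y : K} {s L : ℝ}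
    (hL : dist x y < L) (hs : 0 ≤ s) (hsL : s ≤ L) :
    ∃ z, dist x z ≤ s ∧ dist z y ≤ L - s := by
  obtain ⟨σ, hσ, h0, h1⟩ := hK.exists_lipschitz hL
  refine ⟨σ s, ?_, ?_⟩
  · have := hσ.dist_le_mul 0 s
    rwa [h0, NNReal.coe_one, one_mul, Real.dist_eq, zero_sub, abs_neg, abs_of_nonneg hs] at this
  · have := hσ.dist_le_mul s L
    rwa [h1, NNReal.coe_one, one_mul, Real.dist_eq, abs_sub_comm,
      abs_of_nonneg (sub_nonneg.2 hsL)] at this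

/-- The Hopf-Rinow-Cohn-Vossen theorem: a complete, locally compact length space is proper. -/
theorem IsLengthSpace.properSpace [CompleteSpace K] [LocallyCompactSpace K]
    (hK : IsLengthSpace K) : ProperSpace K := by
  refine ⟨fun x B => ?_⟩
  rcases lt_or_ge B 0 with hB | hB
  · rw [Metric.closedBall_eq_empty.2 hB]; exact isCompact_empty
  set S : Set ℝ := {r | IsCompact (Metric.closedBall x r)} with hS
  have hdown : ∀ r ∈ S, ∀ r' ≤ r, r' ∈ S := fun r hr r' h =>
    IsCompact.of_isClosed_subset hr Metric.isClosed_closedBall (Metric.closedBall_subset_closedBall h)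
  -- The ball of radius `r` lies within `3ε/8` of the compact ball of radius `max (r - ε/4) 0`, so a
  -- finite `ε/2`-net of the latter is an `ε`-net of the former.
  have hlim : ∀ r, 0 < r → (∀ r' < r, r' ∈ S) → r ∈ S := by
    intro r hr h
    refine isCompact_iff_totallyBounded_isComplete.2
      ⟨Metric.totallyBounded_iff.2 fun ε hε => ?_, Metric.isClosed_closedBall.isComplete⟩
    have hr' : max (r - ε / 4) 0 < r := max_lt (by linarith) hr
    obtain ⟨t, ht, hcov⟩ := Metric.totallyBounded_iff.1 (h _ hr').totallyBounded (ε / 2) (by linarith)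
    refine ⟨t, ht, fun y hy => ?_⟩
    rw [Metric.mem_closedBall, dist_comm] at hy
    obtain ⟨z, hz1, hz2⟩ := hK.exists_dist_le (s := max (r - ε / 4) 0) (L := r + ε / 8)
      (hy.trans_lt (by linarith)) (le_max_right _ _) (by linarith)
    obtain ⟨w, hw, hzw⟩ := mem_iUnion₂.1
      (hcov (show z ∈ Metric.closedBall x _ by rwa [Metric.mem_closedBall, dist_comm]))
    refine mem_iUnion₂.2 ⟨w, hw, ?_⟩
    rw [Metric.mem_ball] at hzw ⊢
    have := dist_triangle y z w
    rw [dist_comm z y] at hz2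
    linarith [le_max_left (r - ε / 4) 0]
  -- Local compactness gives a compact thickening of a compact ball, and in a length space this
  -- thickening contains a larger ball.
  have hstep : ∀ r ∈ S, 0 ≤ r → ∃ δ > 0, r + δ ∈ S := by
    intro r hr h0
    obtain ⟨δ, hδ, hc⟩ := IsCompact.exists_isCompact_cthickening hr
    refine ⟨δ / 2, by linarith, IsCompact.of_isClosed_subset hc Metric.isClosed_closedBall ?_⟩
    intro y hy
    rw [Metric.mem_closedBall, dist_comm] at hy
    obtain ⟨z, hz1, hz2⟩ := hK.exists_dist_le (s := r) (L := r + δ)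
      (hy.trans_lt (by linarith)) h0 (by linarith)
    refine Metric.mem_cthickening_of_dist_le y z δ _ (by rwa [Metric.mem_closedBall, dist_comm]) ?_
    rw [dist_comm]; linarith
  have h0 : (0 : ℝ) ∈ S := by
    simp [hS, Metric.closedBall_zero]
  have hcl : IsClosed (S ∩ Icc 0 B) := by
    refine isClosed_of_closure_subset fun r hr => ?_
    have hrI : r ∈ Icc 0 B := closure_minimal inter_subset_right isClosed_Icc hr
    refine ⟨?_, hrI⟩
    rcases hrI.1.eq_or_lt with he | hpos
    · rwa [← he]
    refine hlim r hpos fun r' hr' => ?_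
    obtain ⟨q, hq, hqS⟩ := mem_closure_iff.1 hr (Ioi r') isOpen_Ioi hr'
    exact hdown q hqS.1 r' (le_of_lt hq)
  refine hcl.Icc_subset_of_forall_exists_gt h0 (fun r hr y hy => ?_) ⟨hB, le_rfl⟩
  obtain ⟨δ, hδ, h⟩ := hstep r hr.1 hr.2.1
  exact ⟨min (r + δ) y, hdown _ h _ (min_le_left _ _), lt_min (by linarith) hy, min_le_right _ _⟩

end LengthSpace

/-! ### Support functions of the accessible regions -/

section Cones

open MeasureTheory Filter

variable {m : ℕ} {a : EReal} {b : ℝ} {φ : Fin m → ℝ → ℝ}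

/-- The admissible speeds `φᵢ = fᵢ^(-1/2)` of a multiply warped spacetime over `(a; b)`, integrable
near `b`. -/
structure IsSpeed (a : EReal) (b : ℝ) (φ : Fin m → ℝ → ℝ) : Prop where
  lt : a < (b : EReal)
  nonneg : ∀ i r, 0 ≤ φ i r
  pos : ∀ i, ∀ r ∈ openInterval a b, 0 < φ i r
  continuousOn : ∀ i, ContinuousOn (φ i) (openInterval a b)
  integrable : ∀ i, ∀ t ∈ halfOpenInterval a b, ∀ s ∈ halfOpenInterval a b,
    IntervalIntegrable (φ i) volume t s

theorem ordConnected_halfOpenInterval : (halfOpenInterval a b).OrdConnected :=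
  ⟨fun _ hx _ hy _ hz => ⟨hx.1.trans_le (EReal.coe_le_coe_iff.2 hz.1), hz.2.trans hy.2⟩⟩

theorem ordConnected_openInterval : (openInterval a b).OrdConnected :=
  ⟨fun _ hx _ hy _ hz => ⟨hx.1.trans_le (EReal.coe_le_coe_iff.2 hz.1), hz.2.trans_lt hy.2⟩⟩

theorem openInterval_subset_halfOpenInterval : openInterval a b ⊆ halfOpenInterval a b :=
  fun _ h => ⟨h.1, h.2.le⟩

theorem Ioo_subset_openInterval {t s : ℝ} (ht : t ∈ halfOpenInterval a b)
    (hs : s ∈ halfOpenInterval a b) : Ioo t s ⊆ openInterval a b :=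
  fun _ hr => ⟨ht.1.trans (EReal.coe_lt_coe_iff.2 hr.1), hr.2.trans_le hs.2⟩

theorem exists_lt_mem_openInterval {s : ℝ} (hs : s ∈ halfOpenInterval a b) :
    ∃ t ∈ openInterval a b, t < s := by
  obtain ⟨t, h1, h2⟩ := EReal.lt_iff_exists_real_btwn.1 hs.1
  have h2 := EReal.coe_lt_coe_iff.1 h2
  exact ⟨t, ⟨h1, h2.trans_le hs.2⟩, h2⟩

/-- The norm of the vector `(lᵢ φᵢ(r))ᵢ`. -/
noncomputable def conorm (φ : Fin m → ℝ → ℝ) (l : Fin m → ℝ) (r : ℝ) : ℝ :=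
  ‖(WithLp.toLp 2 fun i => l i * φ i r : EuclideanSpace ℝ (Fin m))‖

/-- The support function of the region that is accessible between the times `t` and `s`. -/
noncomputable def support (φ : Fin m → ℝ → ℝ) (l : Fin m → ℝ) (t s : ℝ) : ℝ :=
  ∫ r in t..s, conorm φ l r

theorem toLp_eq_sum (l : Fin m → ℝ) (r : ℝ) :
    (WithLp.toLp 2 fun i => l i * φ i r : EuclideanSpace ℝ (Fin m)) =
      ∑ i, φ i r • EuclideanSpace.single i (l i) := by
  ext j
  simp [Pi.single_apply, mul_comm]

theorem conorm_nonneg (l : Fin m → ℝ) (r : ℝ) : 0 ≤ conorm φ l r := norm_nonneg _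

theorem abs_mul_le_conorm (hφ : ∀ i r, 0 ≤ φ i r) (l : Fin m → ℝ) (i : Fin m) (r : ℝ) :
    |l i| * φ i r ≤ conorm φ l r := by
  have := PiLp.norm_apply_le (WithLp.toLp 2 fun i => l i * φ i r : EuclideanSpace ℝ (Fin m)) i
  simpa [conorm, abs_mul, abs_of_nonneg (hφ i r)] using this

theorem conorm_le_sum (hφ : ∀ i r, 0 ≤ φ i r) (l : Fin m → ℝ) (r : ℝ) :
    conorm φ l r ≤ ∑ i, |l i| * φ i r := by
  rw [conorm, toLp_eq_sum]
  refine (norm_sum_le _ _).trans (Finset.sum_le_sum fun i _ => ?_)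
  rw [norm_smul, Real.norm_eq_abs, abs_of_nonneg (hφ i r), PiLp.norm_single,
    Real.norm_eq_abs, mul_comm]

theorem mul_conorm_le (hφ : ∀ i r, 0 ≤ φ i r) {κ : ℝ} (hκ : 0 ≤ κ) {r r' : ℝ}
    (h : ∀ i, κ * φ i r ≤ φ i r') (l : Fin m → ℝ) : κ * conorm φ l r ≤ conorm φ l r' := by
  rw [conorm, conorm, EuclideanSpace.norm_eq, EuclideanSpace.norm_eq, ← Real.sqrt_sq hκ,
    ← Real.sqrt_mul (sq_nonneg κ), Finset.mul_sum]
  refine Real.sqrt_le_sqrt (Finset.sum_le_sum fun i _ => ?_)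
  rw [← mul_pow]
  refine pow_le_pow_left₀ (mul_nonneg hκ (norm_nonneg _)) ?_ 2
  simp only [Real.norm_eq_abs, abs_mul, abs_of_nonneg (hφ i _)]
  nlinarith [h i, abs_nonneg (l i)]

/-- Cauchy-Schwarz: `conorm` bounds the progress in direction `l` under a control of norm at most
`1`. -/
theorem sum_mul_le_conorm (l : Fin m → ℝ) (r : ℝ) (w : EuclideanSpace ℝ (Fin m)) :
    ∑ i, (l i * φ i r) * w i ≤ conorm φ l r * ‖w‖ := by
  have := real_inner_le_norm (WithLp.toLp 2 fun i => l i * φ i r : EuclideanSpace ℝ (Fin m)) w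
  rw [PiLp.inner_apply] at this
  refine le_trans (le_of_eq (Finset.sum_congr rfl fun i _ => ?_)) this
  simp [mul_comm]

theorem support_nonneg (l : Fin m → ℝ) {t s : ℝ} (hts : t ≤ s) : 0 ≤ support φ l t s :=
  intervalIntegral.integral_nonneg hts fun _ _ => conorm_nonneg l _

namespace IsSpeed

variable (h : IsSpeed a b φ) {t s r : ℝ}
include h

theorem right_mem : b ∈ halfOpenInterval a b := ⟨h.lt, le_rfl⟩

theorem integrable_conorm (l : Fin m → ℝ) (ht : t ∈ halfOpenInterval a b)
    (hs : s ∈ halfOpenInterval a b) : IntervalIntegrable (conorm φ l) volume t s := by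
  have : IntervalIntegrable
      (fun r => ∑ i, φ i r • (EuclideanSpace.single i (l i) : EuclideanSpace ℝ (Fin m)))
      volume t s := by
    rw [show (fun r => ∑ i, φ i r • (EuclideanSpace.single i (l i) : EuclideanSpace ℝ (Fin m))) =
      ∑ i, fun r => φ i r • (EuclideanSpace.single i (l i) : EuclideanSpace ℝ (Fin m)) from
      funext fun r => by rw [Finset.sum_apply]]
    exact IntervalIntegrable.sum _ fun i _ => ⟨(h.integrable i t ht s hs).1.smul_const _,
        (h.integrable i t ht s hs).2.smul_const _⟩
  have h2 := this.norm
  simp only [← toLp_eq_sum] at h2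
  exact h2

theorem support_add (l : Fin m → ℝ) (ht : t ∈ halfOpenInterval a b)
    (hs : s ∈ halfOpenInterval a b) (hr : r ∈ halfOpenInterval a b) :
    support φ l t s + support φ l s r = support φ l t r :=
  intervalIntegral.integral_add_adjacent_intervals (h.integrable_conorm l ht hs)
    (h.integrable_conorm l hs hr)

theorem support_le_sum (l : Fin m → ℝ) (ht : t ∈ halfOpenInterval a b)
    (hs : s ∈ halfOpenInterval a b) (hts : t ≤ s) :
    support φ l t s ≤ ∑ i, |l i| * ∫ r in t..s, φ i r := by
  have h1 : ∫ r in t..s, ∑ i, |l i| * φ i r = ∑ i, |l i| * ∫ r in t..s, φ i r := by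
    rw [intervalIntegral.integral_finsetSum
      fun i _ => (h.integrable i t ht s hs).const_mul _]
    simp only [intervalIntegral.integral_const_mul]
  rw [← h1]
  refine intervalIntegral.integral_mono_on hts (h.integrable_conorm l ht hs) ?_
    fun r _ => conorm_le_sum h.nonneg l r
  rw [show (fun r => ∑ i, |l i| * φ i r) = ∑ i, fun r => |l i| * φ i r from
    funext fun r => by rw [Finset.sum_apply]]
  exact IntervalIntegrable.sum _ fun i _ => (h.integrable i t ht s hs).const_mul _

theorem abs_support_le_sum (l : Fin m → ℝ) (ht : t ∈ halfOpenInterval a b)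
    (hs : s ∈ halfOpenInterval a b) :
    |support φ l t s| ≤ ∑ i, |l i| * |∫ r in t..s, φ i r| := by
  have key : ∀ t ∈ halfOpenInterval a b, ∀ s ∈ halfOpenInterval a b, t ≤ s →
      |support φ l t s| ≤ ∑ i, |l i| * |∫ r in t..s, φ i r| := by
    intro t ht s hs hts
    rw [abs_of_nonneg (support_nonneg l hts)]
    exact (h.support_le_sum l ht hs hts).trans (Finset.sum_le_sum fun i _ =>
      mul_le_mul_of_nonneg_left (le_abs_self _) (abs_nonneg _))
  rcases le_total t s with hts | hts
  · exact key t ht s hs hts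
  · have := key s hs t ht hts
    simpa only [support, intervalIntegral.integral_symm t s, abs_neg] using this

/-- Each `|lᵢ| ∫ φᵢ` is at most the support function. This is the source of the margins `ε ∑ |lᵢ|`:
a positive time span leaves room in all directions at once. -/
theorem exists_mul_le_support (ht : t ∈ halfOpenInterval a b) (hs : s ∈ halfOpenInterval a b)
    (hts : t < s) : ∃ c > 0, ∀ l : Fin m → ℝ, c * ∑ i, |l i| ≤ support φ l t s := by
  have hΦ : ∀ i, 0 < ∫ r in t..s, φ i r := fun i =>
    intervalIntegral.intervalIntegral_pos_of_pos_on (h.integrable i t ht s hs)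
      (fun r hr => h.pos i r (Ioo_subset_openInterval ht hs hr)) hts
  have hC : 0 ≤ ∑ i, (∫ r in t..s, φ i r)⁻¹ :=
    Finset.sum_nonneg fun i _ => (inv_pos.2 (hΦ i)).le
  refine ⟨(1 + ∑ i, (∫ r in t..s, φ i r)⁻¹)⁻¹, by positivity, fun l => ?_⟩
  rw [inv_mul_le_iff₀ (by positivity)]
  have h1 : ∀ i, |l i| ≤ (∫ r in t..s, φ i r)⁻¹ * support φ l t s := fun i => by
    rw [le_inv_mul_iff₀ (hΦ i), mul_comm, ← intervalIntegral.integral_const_mul]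
    exact intervalIntegral.integral_mono_on hts.le ((h.integrable i t ht s hs).const_mul _)
      (h.integrable_conorm l ht hs) fun r _ => abs_mul_le_conorm h.nonneg l i r
  calc ∑ i, |l i| ≤ ∑ i, (∫ r in t..s, φ i r)⁻¹ * support φ l t s :=
        Finset.sum_le_sum fun i _ => h1 i
    _ = (∑ i, (∫ r in t..s, φ i r)⁻¹) * support φ l t s := by rw [Finset.sum_mul]
    _ ≤ _ := mul_le_mul_of_nonneg_right (by linarith) (support_nonneg l hts.le)

end IsSpeed

/-- Continuity includes the endpoint `b`, by integrability up to `b`. Nothing is assumed at `a`, so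
the primitive is considered on a compact interval ending at `b` that starts before both `s` and `c`.
-/
theorem continuousOn_integral_halfOpenInterval {ψ : ℝ → ℝ}
    (hψ : ∀ t ∈ halfOpenInterval a b, ∀ s ∈ halfOpenInterval a b,
      IntervalIntegrable ψ volume t s) {c : ℝ} (hc : c ∈ halfOpenInterval a b) :
    ContinuousOn (fun s => ∫ r in c..s, ψ r) (halfOpenInterval a b) := by
  intro s hs
  obtain ⟨t, ht, hts⟩ := exists_lt_mem_openInterval hs
  have ht' := openInterval_subset_halfOpenInterval ht
  have hb : b ∈ halfOpenInterval a b := ⟨hs.1.trans_le (EReal.coe_le_coe_iff.2 hs.2), le_rfl⟩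
  have h0 : min t c ∈ halfOpenInterval a b := by
    rcases min_choice t c with h | h <;> rw [h] <;> assumption
  have h1 := intervalIntegral.continuousOn_primitive_interval' (a := c) (hψ _ h0 b hb)
    (by rw [uIcc_of_le h0.2]; exact ⟨min_le_right _ _, hc.2⟩)
  rw [uIcc_of_le h0.2] at h1
  have hlt : min t c < s := (min_le_left _ _).trans_lt hts
  refine (h1 s ⟨hlt.le, hs.2⟩).mono_of_mem_nhdsWithin ?_
  filter_upwards [mem_nhdsWithin_of_mem_nhds (Ioi_mem_nhds hlt), self_mem_nhdsWithin] with x hx hx'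
  exact ⟨le_of_lt hx, hx'.2⟩

end Cones

/-! ### Causal and chronological relations defined by support functions -/

section Relations

open MeasureTheory Filter

universe v

variable {m : ℕ} {a : EReal} {b : ℝ} {φ : Fin m → ℝ → ℝ}
  {K : Fin m → Type v} [∀ i, MetricSpace (K i)] {J J₁ J₂ J₃ : Set ℝ}

/-- The weighted distance `∑ |lᵢ| dᵢ`. -/
noncomputable def weightedDist (l : Fin m → ℝ) (x y : (i : Fin m) → K i) : ℝ :=
  ∑ i, |l i| * dist (x i) (y i)

theorem weightedDist_triangle (l : Fin m → ℝ) (x y z : (i : Fin m) → K i) :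
    weightedDist l x z ≤ weightedDist l x y + weightedDist l y z := by
  rw [weightedDist, weightedDist, weightedDist, ← Finset.sum_add_distrib]
  refine Finset.sum_le_sum fun i _ => ?_
  rw [← mul_add]
  exact mul_le_mul_of_nonneg_left (dist_triangle _ _ _) (abs_nonneg _)

theorem weightedDist_self (l : Fin m → ℝ) (x : (i : Fin m) → K i) : weightedDist l x x = 0 := by
  simp [weightedDist]

theorem continuous_weightedDist_left (l : Fin m → ℝ) (y : (i : Fin m) → K i) :
    Continuous fun x => weightedDist l x y := by
  unfold weightedDist
  fun_prop

theorem continuous_weightedDist_right (l : Fin m → ℝ) (x : (i : Fin m) → K i) :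
    Continuous fun y => weightedDist l x y := by
  unfold weightedDist
  fun_prop

/-- `p` is in the causal past of `q`, in terms of support functions. -/
def Causal (φ : Fin m → ℝ → ℝ) (p : Warped J₁ K) (q : Warped J₂ K) : Prop :=
  (p.1 : ℝ) ≤ q.1 ∧ ∀ l, weightedDist l p.2 q.2 ≤ support φ l p.1 q.1

/-- `p` is in the chronological past of `q`, in terms of support functions. -/
def Timelike (φ : Fin m → ℝ → ℝ) (p : Warped J₁ K) (q : Warped J₂ K) : Prop :=
  (p.1 : ℝ) < q.1 ∧ ∃ ε > 0, ∀ l, weightedDist l p.2 q.2 + ε * ∑ i, |l i| ≤ support φ l p.1 q.1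

theorem Timelike.causal {p : Warped J₁ K} {q : Warped J₂ K} (hpq : Timelike φ p q) :
    Causal φ p q := by
  obtain ⟨h1, ε, hε, h2⟩ := hpq
  refine ⟨h1.le, fun l => le_trans ?_ (h2 l)⟩
  exact le_add_of_nonneg_right
    (mul_nonneg hε.le (Finset.sum_nonneg fun i _ => abs_nonneg (l i)))

/-- The times agree, so the support function vanishes; the unit vectors `l` then show that all
coordinates agree. -/
theorem Causal.antisymm {p q : Warped J K} (hpq : Causal φ p q) (hqp : Causal φ q p) :
    p = q := by
  have ht : (p.1 : ℝ) = q.1 := le_antisymm hpq.1 hqp.1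
  refine Prod.ext (Subtype.ext ht) (funext fun i => ?_)
  have h1 := hpq.2 (Pi.single i 1)
  rw [support, ht, intervalIntegral.integral_same, weightedDist,
    Finset.sum_eq_single i (fun j _ hj => by simp [hj]) (by simp)] at h1
  simpa using h1

namespace IsSpeed

variable (h : IsSpeed a b φ)
include h

/-- Support functions add up over adjacent time intervals and weighted distances obey the triangle
inequality, so the margin of one step survives composition. -/
theorem causal_timelike {p : Warped J₁ K} {q : Warped J₂ K} {r : Warped J₃ K}
    (h₁ : J₁ ⊆ halfOpenInterval a b) (h₂ : J₂ ⊆ halfOpenInterval a b)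
    (h₃ : J₃ ⊆ halfOpenInterval a b) (hpq : Causal φ p q) (hqr : Timelike φ q r) :
    Timelike φ p r := by
  obtain ⟨h4, ε, hε, h5⟩ := hqr
  refine ⟨hpq.1.trans_lt h4, ε, hε, fun l => ?_⟩
  rw [← h.support_add l (h₁ p.1.2) (h₂ q.1.2) (h₃ r.1.2)]
  linarith [weightedDist_triangle l p.2 q.2 r.2, hpq.2 l, h5 l]

theorem timelike_causal {p : Warped J₁ K} {q : Warped J₂ K} {r : Warped J₃ K}
    (h₁ : J₁ ⊆ halfOpenInterval a b) (h₂ : J₂ ⊆ halfOpenInterval a b)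
    (h₃ : J₃ ⊆ halfOpenInterval a b) (hpq : Timelike φ p q) (hqr : Causal φ q r) :
    Timelike φ p r := by
  obtain ⟨h4, ε, hε, h5⟩ := hpq
  refine ⟨h4.trans_le hqr.1, ε, hε, fun l => ?_⟩
  rw [← h.support_add l (h₁ p.1.2) (h₂ q.1.2) (h₃ r.1.2)]
  linarith [weightedDist_triangle l p.2 q.2 r.2, hqr.2 l, h5 l]

theorem timelike_trans {p : Warped J₁ K} {q : Warped J₂ K} {r : Warped J₃ K}
    (h₁ : J₁ ⊆ halfOpenInterval a b) (h₂ : J₂ ⊆ halfOpenInterval a b)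
    (h₃ : J₃ ⊆ halfOpenInterval a b) (hpq : Timelike φ p q) (hqr : Timelike φ q r) :
    Timelike φ p r := h.timelike_causal h₁ h₂ h₃ hpq hqr.causal

theorem continuous_support_right (l : Fin m → ℝ) {c : ℝ} (hc : c ∈ halfOpenInterval a b)
    (hJ : J ⊆ halfOpenInterval a b) :
    Continuous fun q : Warped J K => support φ l c q.1 :=
  (continuousOn_integral_halfOpenInterval (fun _ ht _ hs => h.integrable_conorm l ht hs)
    hc).comp_continuous (f := fun q : Warped J K => (q.1 : ℝ)) (by fun_prop) fun q => hJ q.1.2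

theorem isClosed_causal_right (h₁ : J₁ ⊆ halfOpenInterval a b) (h₂ : J₂ ⊆ halfOpenInterval a b)
    (p : Warped J₁ K) : IsClosed {q : Warped J₂ K | Causal φ p q} := by
  have e : {q : Warped J₂ K | Causal φ p q} = {q | (p.1 : ℝ) ≤ q.1} ∩
      ⋂ l, {q | weightedDist l p.2 q.2 ≤ support φ l p.1 q.1} := by
    ext q
    simp [Causal]
  rw [e]
  refine (isClosed_le continuous_const (continuous_subtype_val.comp continuous_fst)).inter ?_
  exact isClosed_iInter fun l => isClosed_le
    ((continuous_weightedDist_right l p.2).comp continuous_snd)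
    (h.continuous_support_right l (h₁ p.1.2) h₂)

theorem isClosed_causal_left (h₁ : J₁ ⊆ halfOpenInterval a b) (h₂ : J₂ ⊆ halfOpenInterval a b)
    (q : Warped J₂ K) : IsClosed {p : Warped J₁ K | Causal φ p q} := by
  have e : {p : Warped J₁ K | Causal φ p q} = {p | (p.1 : ℝ) ≤ q.1} ∩
      ⋂ l, {p | weightedDist l p.2 q.2 ≤ support φ l p.1 q.1} := by
    ext p
    simp [Causal]
  rw [e]
  refine (isClosed_le (continuous_subtype_val.comp continuous_fst) continuous_const).inter ?_
  refine isClosed_iInter fun l => isClosed_le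
    ((continuous_weightedDist_left l q.2).comp continuous_snd) ?_
  have h1 := (h.continuous_support_right (K := K) l (h₂ q.1.2) h₁).neg
  refine h1.congr fun p => ?_
  show -support φ l q.1 p.1 = support φ l p.1 q.1
  rw [support, support, intervalIntegral.integral_symm, neg_neg]

/-- The weighted oscillation of times and positions near a point is small. -/
theorem eventually_abs_support_add_weightedDist_le (hJ : J ⊆ halfOpenInterval a b)
    (q₀ : Warped J K) {ε : ℝ} (hε : 0 < ε) :
    ∀ᶠ q : Warped J K in 𝓝 q₀, ∀ l,
      |support φ l q₀.1 q.1| + weightedDist l q₀.2 q.2 ≤ ε * ∑ i, |l i| := by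
  have h1 : ∀ᶠ q : Warped J K in 𝓝 q₀, ∀ i,
      |∫ r in (q₀.1 : ℝ)..q.1, φ i r| + dist (q₀.2 i) (q.2 i) < ε := by
    refine eventually_all.2 fun i => ?_
    have hc : Continuous fun q : Warped J K =>
        |∫ r in (q₀.1 : ℝ)..q.1, φ i r| + dist (q₀.2 i) (q.2 i) := by
      refine Continuous.add (Continuous.abs ?_) (by fun_prop)
      exact (continuousOn_integral_halfOpenInterval (h.integrable i)
        (hJ q₀.1.2)).comp_continuous (f := fun q : Warped J K => (q.1 : ℝ)) (by fun_prop)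
          fun q => hJ q.1.2
    refine hc.tendsto q₀ |>.eventually_lt_const ?_
    simpa using hε
  filter_upwards [h1] with q hq l
  refine (add_le_add_left (h.abs_support_le_sum l (hJ q₀.1.2) (hJ q.1.2)) _).trans ?_
  rw [weightedDist, ← Finset.sum_add_distrib, Finset.mul_sum]
  refine Finset.sum_le_sum fun i _ => ?_
  rw [← mul_add, mul_comm]
  exact mul_le_mul_of_nonneg_right (hq i).le (abs_nonneg _)

/-- Half of the margin absorbs a small displacement of the endpoint, uniformly in `l`. -/
theorem eventually_timelike_right (h₁ : J₁ ⊆ halfOpenInterval a b)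
    (h₂ : J₂ ⊆ halfOpenInterval a b) {p : Warped J₁ K} {q₀ : Warped J₂ K}
    (hpq : Timelike φ p q₀) : ∀ᶠ q in 𝓝 q₀, Timelike φ p q := by
  obtain ⟨h4, ε, hε, h5⟩ := hpq
  have h6 : ∀ᶠ q : Warped J₂ K in 𝓝 q₀, (p.1 : ℝ) < q.1 :=
    (show Continuous fun q : Warped J₂ K => (q.1 : ℝ) by fun_prop).tendsto q₀
      |>.eventually_const_lt h4
  filter_upwards [h6, h.eventually_abs_support_add_weightedDist_le h₂ q₀ (half_pos hε)]
    with q hq hq'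
  refine ⟨hq, ε / 2, half_pos hε, fun l => ?_⟩
  rw [← h.support_add l (h₁ p.1.2) (h₂ q₀.1.2) (h₂ q.1.2)]
  linarith [weightedDist_triangle l p.2 q₀.2 q.2, h5 l, hq' l,
    neg_abs_le (support φ l q₀.1 q.1)]

/-- Every point has points of its chronological past arbitrarily near. -/
theorem exists_timelike_mem_nhds (q : Warped (halfOpenInterval a b) K)
    {U : Set (Warped (halfOpenInterval a b) K)} (hU : U ∈ 𝓝 q) :
    ∃ p : Warped (openInterval a b) K, Timelike φ p q ∧
      ((⟨p.1, openInterval_subset_halfOpenInterval p.1.2⟩, p.2) :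
        Warped (halfOpenInterval a b) K) ∈ U := by
  obtain ⟨t₀, ht₀, hlt⟩ := exists_lt_mem_openInterval q.1.2
  -- The vertical line through `q`, with time clamped to `[t₀; q.1]` so that it is defined and
  -- continuous on all of `ℝ`.
  set g : ℝ → Warped (halfOpenInterval a b) K := fun t =>
    (⟨projIcc t₀ q.1 hlt.le t, ordConnected_halfOpenInterval.out
      (openInterval_subset_halfOpenInterval ht₀) q.1.2 (projIcc t₀ q.1 hlt.le t).2⟩, q.2) with hg
  have hgc : Continuous g := by
    refine Continuous.prodMk (Continuous.subtype_mk ?_ _) continuous_const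
    exact continuous_subtype_val.comp continuous_projIcc
  have hgq : g q.1 = q := by
    refine Prod.ext (Subtype.ext ?_) rfl
    simp [hg, projIcc_right]
  have hev : ∀ᶠ t in 𝓝[<] (q.1 : ℝ), g t ∈ U :=
    nhdsWithin_le_nhds (hgc.tendsto _ (by rwa [hgq]))
  obtain ⟨t, htU, ht1, ht2⟩ := (hev.and (Ioo_mem_nhdsLT hlt)).exists
  have htO : t ∈ openInterval a b := ⟨ht₀.1.trans (EReal.coe_lt_coe_iff.2 ht1), ht2.trans_le q.1.2.2⟩
  refine ⟨(⟨t, htO⟩, q.2), ⟨ht2, ?_⟩, ?_⟩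
  · obtain ⟨c, hc, hcl⟩ := h.exists_mul_le_support
      (openInterval_subset_halfOpenInterval htO) q.1.2 ht2
    exact ⟨c, hc, fun l => by rw [weightedDist_self, zero_add]; exact hcl l⟩
  · convert htU using 1
    refine Prod.ext (Subtype.ext ?_) rfl
    simp [hg, projIcc_of_mem hlt.le ⟨ht1.le, ht2.le⟩]

end IsSpeed

end Relations

/-! ### Good paths satisfy the support inequalities -/

section GoodPaths

open MeasureTheory Filter

universe v

variable {m : ℕ} {a : EReal} {b : ℝ} {φ : Fin m → ℝ → ℝ} {f : Fin m → ℝ → ℝ}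
  {K : Fin m → Type v} [∀ i, MetricSpace (K i)] {J : Set ℝ}

theorem isOpen_openInterval : IsOpen (openInterval a b) :=
  (isOpen_Ioi.preimage continuous_coe_real_ereal).inter isOpen_Iio

theorem isSpeed_inv_sqrt (hab : a < (b : EReal)) (hpos : ∀ i, ∀ t ∈ openInterval a b, 0 < f i t)
    (hf : ∀ i, ContinuousOn (f i) (openInterval a b))
    (hint : ∀ i, ∃ c ∈ openInterval a b,
      IntegrableOn (fun t => f i t ^ (-(1 / 2) : ℝ)) (Ioo c b)) :
    IsSpeed a b fun i r => (√(f i r))⁻¹ := by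
  have hcont : ∀ i, ContinuousOn (fun r => (√(f i r))⁻¹) (openInterval a b) := fun i =>
    (hf i).sqrt.inv₀ fun r hr => (Real.sqrt_pos.2 (hpos i r hr)).ne'
  refine ⟨hab, fun i r => inv_nonneg.2 (Real.sqrt_nonneg _),
    fun i r hr => inv_pos.2 (Real.sqrt_pos.2 (hpos i r hr)), hcont, fun i => ?_⟩
  obtain ⟨c, hc, hci⟩ := hint i
  have hcb : IntervalIntegrable (fun r => (√(f i r))⁻¹) volume c b := by
    rw [intervalIntegrable_iff_integrableOn_Ioo_of_le hc.2.le]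
    refine hci.congr_fun (fun r hr => ?_) measurableSet_Ioo
    have hrO : r ∈ openInterval a b := ⟨hc.1.trans (EReal.coe_lt_coe_iff.2 hr.1), hr.2⟩
    show f i r ^ (-(1 / 2) : ℝ) = (√(f i r))⁻¹
    rw [Real.rpow_neg (hpos i r hrO).le, Real.sqrt_eq_rpow]
  have key : ∀ t ∈ halfOpenInterval a b,
      IntervalIntegrable (fun r => (√(f i r))⁻¹) volume c t := by
    intro t ht
    rcases ht.2.eq_or_lt with he | hlt
    · rwa [he]
    · exact ((hcont i).mono (ordConnected_openInterval.uIcc_subset hc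
        ⟨ht.1, hlt⟩)).intervalIntegrable
  exact fun t ht s hs => (key t ht).symm.trans (key s hs)

theorem conorm_abs (l : Fin m → ℝ) (r : ℝ) : conorm φ (fun i => |l i|) r = conorm φ l r := by
  simp [conorm, EuclideanSpace.norm_eq, mul_pow]

namespace IsGoodPath

variable {p q : Warped J K} {c : ℝ → Warped J K}

/-- Near `r` the Lipschitz bounds refer to the speeds frozen at `r`. By Cauchy-Schwarz they gain a
factor less than `1`, part of which pays for replacing the frozen speeds by the actual ones. -/
theorem exists_weightedDist_le_mul_support (hc : IsGoodPath f p q c)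
    (h : IsSpeed a b fun i r => (√(f i r))⁻¹) (hJ : J ⊆ halfOpenInterval a b)
    {r : ℝ} (hr : r ∈ Ioo (p.1 : ℝ) q.1) :
    ∃ θ < 1, ∃ u₀ u₁, u₀ < r ∧ r < u₁ ∧ Icc u₀ u₁ ⊆ Ioo (p.1 : ℝ) q.1 ∧
      ∀ u ∈ Icc u₀ u₁, ∀ v ∈ Icc u₀ u₁, u ≤ v → ∀ l : Fin m → ℝ,
        weightedDist l (c u).2 (c v).2 ≤ θ * support (fun i r => (√(f i r))⁻¹) l u v := by
  have hsub := Ioo_subset_openInterval (hJ p.1.2) (hJ q.1.2)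
  have hrO := hsub hr
  obtain ⟨U, hU, k, hk, hlip⟩ := hc.lipschitz r hr
  set κ : ℝ := ‖(WithLp.toLp 2 fun i => (k i : ℝ) : EuclideanSpace ℝ (Fin m))‖ with hκ
  have hκ1 : κ < 1 := by
    rw [hκ, EuclideanSpace.norm_eq, Real.sqrt_lt' one_pos, one_pow]
    simpa using (by exact_mod_cast hk : ∑ i, (k i : ℝ) ^ 2 < 1)
  have hκ0 : 0 ≤ κ := norm_nonneg _
  -- Since `κ' < 1`, continuity gives `κ' φᵢ(r) ≤ φᵢ(r')` for `r'` near `r`; since `κ < κ'`, the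
  -- factor `κ / κ'` is still less than `1`.
  obtain ⟨κ', h1, h2⟩ := exists_between hκ1
  have hκ' : 0 < κ' := hκ0.trans_lt h1
  have hev : ∀ᶠ r' in 𝓝 r, ∀ i, κ' * (√(f i r))⁻¹ ≤ (√(f i r'))⁻¹ := by
    refine eventually_all.2 fun i => ?_
    have hct : ContinuousAt (fun r => (√(f i r))⁻¹) r :=
      (h.continuousOn i).continuousAt (isOpen_openInterval.mem_nhds hrO)
    have hp : 0 < (√(f i r))⁻¹ := h.pos i r hrO
    exact (hct.eventually_const_lt (by nlinarith : κ' * (√(f i r))⁻¹ < (√(f i r))⁻¹)).mono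
      fun _ hx => hx.le
  obtain ⟨δ, hδ, hball⟩ := Metric.nhds_basis_closedBall.mem_iff.1
    (inter_mem hU (inter_mem (Ioo_mem_nhds hr.1 hr.2) hev))
  rw [Real.closedBall_eq_Icc] at hball
  refine ⟨κ / κ', (div_lt_one hκ').2 h1, r - δ, r + δ, by linarith, by linarith,
    fun u hu => (hball hu).2.1, fun u hu v hv huv l => ?_⟩
  have hu' := hball hu
  have hv' := hball hv
  have hd : ∀ i, dist ((c u).2 i) ((c v).2 i) ≤ (√(f i r))⁻¹ * k i * (v - u) := fun i => by
    have h3 := hlip i u ⟨hu'.1, Ioo_subset_Icc_self hu'.2.1⟩ v ⟨hv'.1, Ioo_subset_Icc_self hv'.2.1⟩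
    rw [abs_sub_comm, abs_of_nonneg (sub_nonneg.2 huv)] at h3
    have hp : 0 < √(f i r) := inv_pos.1 (h.pos i r hrO)
    rwa [mul_assoc, le_inv_mul_iff₀ hp]
  have hsum : weightedDist l (c u).2 (c v).2 ≤
      conorm (fun i r => (√(f i r))⁻¹) l r * κ * (v - u) := by
    refine le_trans ?_ (mul_le_mul_of_nonneg_right (sum_mul_le_conorm (fun i => |l i|) r
      (WithLp.toLp 2 fun i => (k i : ℝ))) (sub_nonneg.2 huv) |>.trans_eq (by rw [conorm_abs]))
    rw [weightedDist, Finset.sum_mul]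
    refine Finset.sum_le_sum fun i _ => ?_
    refine (mul_le_mul_of_nonneg_left (hd i) (abs_nonneg _)).trans_eq ?_
    simp only []
    ring
  have hint : κ' * conorm (fun i r => (√(f i r))⁻¹) l r * (v - u) ≤
      support (fun i r => (√(f i r))⁻¹) l u v := by
    have h4 := intervalIntegral.integral_mono_on huv
      (intervalIntegrable_const (c := κ' * conorm (fun i r => (√(f i r))⁻¹) l r) (μ := volume))
      (h.integrable_conorm l (openInterval_subset_halfOpenInterval (hsub hu'.2.1))
        (openInterval_subset_halfOpenInterval (hsub hv'.2.1)))
      fun r' hr' => mul_conorm_le h.nonneg hκ'.le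
        (hball ⟨hu.1.trans hr'.1, hr'.2.trans hv.2⟩).2.2 l
    rw [intervalIntegral.integral_const, smul_eq_mul, mul_comm] at h4
    exact h4
  refine hsum.trans ((le_of_eq ?_).trans (mul_le_mul_of_nonneg_left hint (div_nonneg hκ0 hκ'.le)))
  field_simp

/-- The local estimates are chained by continuous induction inside the open interval. The Lipschitz
condition says nothing at the endpoints, which are reached by continuity, first the right one and
then the left one. -/
theorem weightedDist_le_support (hc : IsGoodPath f p q c)
    (h : IsSpeed a b fun i r => (√(f i r))⁻¹) (hJ : J ⊆ halfOpenInterval a b)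
    {u v : ℝ} (hu : u ∈ Icc (p.1 : ℝ) q.1) (hv : v ∈ Icc (p.1 : ℝ) q.1) (huv : u ≤ v)
    (l : Fin m → ℝ) :
    weightedDist l (c u).2 (c v).2 ≤ support (fun i r => (√(f i r))⁻¹) l u v := by
  have hH : Icc (p.1 : ℝ) q.1 ⊆ halfOpenInterval a b :=
    ordConnected_halfOpenInterval.out (hJ p.1.2) (hJ q.1.2)
  have hc2 : ContinuousOn (fun w => (c w).2) (Icc (p.1 : ℝ) q.1) :=
    continuous_snd.comp_continuousOn hc.continuousOn
  have hsupp : ∀ u ∈ Icc (p.1 : ℝ) q.1, ContinuousOn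
      (fun w => support (fun i r => (√(f i r))⁻¹) l u w) (Icc (p.1 : ℝ) q.1) := fun u hu =>
    (continuousOn_integral_halfOpenInterval (fun _ ht _ hs => h.integrable_conorm l ht hs)
      (hH hu)).mono hH
  have hright : ∀ u ∈ Icc (p.1 : ℝ) q.1, ContinuousOn
      (fun w => weightedDist l (c u).2 (c w).2) (Icc (p.1 : ℝ) q.1) := fun u _ =>
    (continuous_weightedDist_right l (c u).2).comp_continuousOn hc2
  have hinner : ∀ u ∈ Ioo (p.1 : ℝ) q.1, ∀ v ∈ Ioo (p.1 : ℝ) q.1, u ≤ v →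
      weightedDist l (c u).2 (c v).2 ≤ support (fun i r => (√(f i r))⁻¹) l u v := by
    intro u hu v hv huv
    have hsub : Icc u v ⊆ Icc (p.1 : ℝ) q.1 := Icc_subset_Icc hu.1.le hv.2.le
    have hu' := Ioo_subset_Icc_self hu
    have hcl : IsClosed ({w | weightedDist l (c u).2 (c w).2 ≤
        support (fun i r => (√(f i r))⁻¹) l u w} ∩ Icc u v) := by
      have := isClosed_Icc.isClosed_le ((hright u hu').mono hsub) ((hsupp u hu').mono hsub)
      convert this using 1
      ext w
      exact and_comm
    refine hcl.Icc_subset_of_forall_exists_gt ?_ (fun w hw y hy => ?_) ⟨huv, le_rfl⟩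
    · show weightedDist l (c u).2 (c u).2 ≤ _
      rw [weightedDist_self, support, intervalIntegral.integral_same]
    · have hwI : w ∈ Ioo (p.1 : ℝ) q.1 := ⟨hu.1.trans_le hw.2.1, hw.2.2.trans hv.2⟩
      obtain ⟨θ, hθ, u₀, u₁, h0, h1, hI, hle⟩ := hc.exists_weightedDist_le_mul_support h hJ hwI
      have hwz : w < min u₁ y := lt_min h1 hy
      have hzI : min u₁ y ∈ Icc u₀ u₁ := ⟨h0.le.trans hwz.le, min_le_left _ _⟩
      refine ⟨min u₁ y, ?_, hwz, min_le_right _ _⟩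
      have h2 := hle w ⟨h0.le, h1.le⟩ _ hzI hwz.le l
      have h3 : 0 ≤ support (fun i r => (√(f i r))⁻¹) l w (min u₁ y) := support_nonneg l hwz.le
      have h4 := h.support_add l (hH hu') (hH (Ioo_subset_Icc_self hwI))
        (hH (Ioo_subset_Icc_self (hI hzI)))
      have h5 : weightedDist l (c u).2 (c w).2 ≤ _ := hw.1
      show weightedDist l (c u).2 (c (min u₁ y)).2 ≤ _
      nlinarith [weightedDist_triangle l (c u).2 (c w).2 (c (min u₁ y)).2]
  have hr : ∀ u ∈ Ioo (p.1 : ℝ) q.1, ∀ v ∈ Icc u q.1,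
      weightedDist l (c u).2 (c v).2 ≤ support (fun i r => (√(f i r))⁻¹) l u v := by
    intro u hu v hv
    have hu' := Ioo_subset_Icc_self hu
    have hsub : Icc u (q.1 : ℝ) ⊆ Icc (p.1 : ℝ) q.1 := Icc_subset_Icc_left hu.1.le
    have hcl := isClosed_Icc.isClosed_le ((hright u hu').mono hsub) ((hsupp u hu').mono hsub)
    rw [← closure_Ioo hu.2.ne] at hv
    exact (hcl.closure_subset_iff.2 (fun w hw => ⟨Ioo_subset_Icc_self hw,
      hinner u hu w ⟨hu.1.trans hw.1, hw.2⟩ hw.1.le⟩) hv).2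
  rcases huv.eq_or_lt with rfl | hlt
  · rw [weightedDist_self, support, intervalIntegral.integral_same]
  have hsub : Icc (p.1 : ℝ) v ⊆ Icc (p.1 : ℝ) q.1 := Icc_subset_Icc_right hv.2
  have hcl := isClosed_Icc.isClosed_le
    (((continuous_weightedDist_left l (c v).2).comp_continuousOn hc2).mono hsub)
    ((hsupp v hv).neg.mono hsub)
  have hpv : (p.1 : ℝ) < v := hu.1.trans_lt hlt
  have := (hcl.closure_subset_iff.2 (fun w hw => ⟨Ioo_subset_Icc_self hw, by
    have := hr w ⟨hw.1, hw.2.trans_le hv.2⟩ v ⟨hw.2.le, hv.2⟩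
    rw [support, intervalIntegral.integral_symm] at this
    exact this⟩) (by rw [closure_Ioo hpv.ne]; exact ⟨hu.1, huv⟩ :
      u ∈ closure (Ioo (p.1 : ℝ) v))).2
  rw [support, intervalIntegral.integral_symm]
  exact this

/-- The factor `θ < 1` on one short interval already saves `1 - θ` times its support function, which
dominates a multiple of `∑ |lᵢ|`. -/
theorem timelike (hc : IsGoodPath f p q c) (h : IsSpeed a b fun i r => (√(f i r))⁻¹)
    (hJ : J ⊆ halfOpenInterval a b) : Timelike (fun i r => (√(f i r))⁻¹) p q := by
  obtain ⟨r, hr⟩ := exists_between hc.lt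
  obtain ⟨θ, hθ, u₀, u₁, h0, h1, hI, hle⟩ := hc.exists_weightedDist_le_mul_support h hJ hr
  have h01 : u₀ < u₁ := h0.trans h1
  have hu₀ := Ioo_subset_Icc_self (hI (left_mem_Icc.2 h01.le))
  have hu₁ := Ioo_subset_Icc_self (hI (right_mem_Icc.2 h01.le))
  have hH : Icc (p.1 : ℝ) q.1 ⊆ halfOpenInterval a b :=
    ordConnected_halfOpenInterval.out (hJ p.1.2) (hJ q.1.2)
  have hp : (p.1 : ℝ) ∈ Icc (p.1 : ℝ) q.1 := left_mem_Icc.2 hc.lt.le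
  have hq : (q.1 : ℝ) ∈ Icc (p.1 : ℝ) q.1 := right_mem_Icc.2 hc.lt.le
  obtain ⟨κ, hκ, hκl⟩ := h.exists_mul_le_support (hH hu₀) (hH hu₁) h01
  refine ⟨hc.lt, (1 - θ) * κ, mul_pos (by linarith) hκ, fun l => ?_⟩
  have e1 := hc.weightedDist_le_support h hJ hp hu₀ hu₀.1 l
  have e2 := hle u₀ (left_mem_Icc.2 h01.le) u₁ (right_mem_Icc.2 h01.le) h01.le l
  have e3 := hc.weightedDist_le_support h hJ hu₁ hq hu₁.2 l
  have e4 := h.support_add l (hH hp) (hH hu₀) (hH hu₁)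
  have e5 := h.support_add l (hH hp) (hH hu₁) (hH hq)
  have e6 := mul_le_mul_of_nonneg_left (hκl l) (by linarith : 0 ≤ 1 - θ)
  rw [hc.source] at e1
  rw [hc.target] at e3
  have t1 := weightedDist_triangle l p.2 (c u₀).2 (c u₁).2
  have t2 := weightedDist_triangle l p.2 (c u₁).2 q.2
  linarith

end IsGoodPath

end GoodPaths

/-! ### Construction of good paths by convex duality -/

section GoodPathExistence

open MeasureTheory Filter

universe v

variable {m : ℕ} {a : EReal} {b : ℝ} {φ : Fin m → ℝ → ℝ} {f : Fin m → ℝ → ℝ}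
  {K : Fin m → Type v} [∀ i, MetricSpace (K i)] {J : Set ℝ}

/-- The displacements that are realised between the times `t` and `s` by continuous controls of
norm less than `1`. -/
def reachable (φ : Fin m → ℝ → ℝ) (t s : ℝ) : Set (Fin m → ℝ) :=
  {ρ | ∃ w : ℝ → EuclideanSpace ℝ (Fin m), ContinuousOn w (Ioo t s) ∧
    (∀ r ∈ Ioo t s, ‖w r‖ < 1) ∧ ∀ i, ρ i = ∫ r in t..s, w r i * φ i r}

namespace IsSpeed

variable (h : IsSpeed a b φ) {t s : ℝ}
include h

theorem intervalIntegrable_control (ht : t ∈ halfOpenInterval a b) (hs : s ∈ halfOpenInterval a b)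
    (hts : t ≤ s) {w : ℝ → EuclideanSpace ℝ (Fin m)} (hw : ContinuousOn w (Ioo t s))
    (hw1 : ∀ r ∈ Ioo t s, ‖w r‖ < 1) (i : Fin m) :
    IntervalIntegrable (fun r => w r i * φ i r) volume t s := by
  have hφ := h.integrable i t ht s hs
  rw [intervalIntegrable_iff_integrableOn_Ioo_of_le hts] at hφ ⊢
  have hwi : ContinuousOn (fun r => w r i) (Ioo t s) :=
    (by fun_prop : Continuous fun x : EuclideanSpace ℝ (Fin m) => x i).comp_continuousOn hw
  refine Integrable.bdd_mul (c := 1) hφ (hwi.aestronglyMeasurable measurableSet_Ioo) ?_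
  filter_upwards [ae_restrict_mem measurableSet_Ioo] with r hr
  exact (PiLp.norm_apply_le (w r) i).trans (hw1 r hr).le

theorem convex_reachable (ht : t ∈ halfOpenInterval a b) (hs : s ∈ halfOpenInterval a b)
    (hts : t ≤ s) : Convex ℝ (reachable φ t s) := by
  rintro ρ ⟨w, hw, hw1, hρ⟩ ρ' ⟨w', hw', hw1', hρ'⟩ α β hα hβ hαβ
  refine ⟨fun r => α • w r + β • w' r, (hw.const_smul α).add (hw'.const_smul β),
    fun r hr => ?_, fun i => ?_⟩
  · have := convex_ball (0 : EuclideanSpace ℝ (Fin m)) 1 (x := w r) (by simpa using hw1 r hr)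
      (y := w' r) (by simpa using hw1' r hr) hα hβ hαβ
    simpa using this
  · have h1 := h.intervalIntegrable_control ht hs hts hw hw1 i
    have h2 := h.intervalIntegrable_control ht hs hts hw' hw1' i
    have e : ∀ r, (α • w r + β • w' r : EuclideanSpace ℝ (Fin m)) i * φ i r =
        α * (w r i * φ i r) + β * (w' r i * φ i r) := fun r => by
      simp only [PiLp.add_apply, PiLp.smul_apply, smul_eq_mul]
      ring
    simp only [e]
    rw [intervalIntegral.integral_add (h1.const_mul _) (h2.const_mul _),
      intervalIntegral.integral_const_mul, intervalIntegral.integral_const_mul, ← hρ, ← hρ']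
    simp

/-- The optimal control in direction `l` is the normalised vector `(lᵢ φᵢ)ᵢ`; the factor `θ` keeps
its norm below `1`. -/
theorem exists_mem_reachable_sum_eq (ht : t ∈ halfOpenInterval a b)
    (hs : s ∈ halfOpenInterval a b) (hts : t ≤ s) (l : Fin m → ℝ) {θ : ℝ} (hθ : 0 ≤ θ)
    (hθ1 : θ < 1) : ∃ ρ ∈ reachable φ t s, ∑ i, l i * ρ i = θ * support φ l t s := by
  set w : ℝ → EuclideanSpace ℝ (Fin m) := fun r =>
    (θ * (conorm φ l r)⁻¹) • WithLp.toLp 2 fun i => l i * φ i r with hw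
  have hwc : ContinuousOn w (Ioo t s) := by
    by_cases hl : l = 0
    · refine (continuousOn_const (c := 0)).congr fun r _ => ?_
      ext i
      simp [hw, hl]
    obtain ⟨j, hj⟩ := Function.ne_iff.1 hl
    have hv : ContinuousOn (fun r => (WithLp.toLp 2 fun i => l i * φ i r :
        EuclideanSpace ℝ (Fin m))) (Ioo t s) :=
      (PiLp.continuous_toLp 2 _).comp_continuousOn (continuousOn_pi.2 fun i =>
        continuousOn_const.mul ((h.continuousOn i).mono (Ioo_subset_openInterval ht hs)))
    refine (continuousOn_const.mul (hv.norm.inv₀ fun r hr => ?_)).smul hv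
    have h1 := abs_mul_le_conorm h.nonneg l j r
    have h2 := mul_pos (abs_pos.2 hj) (h.pos j r (Ioo_subset_openInterval ht hs hr))
    exact (h2.trans_le h1).ne'
  have hw1 : ∀ r ∈ Ioo t s, ‖w r‖ < 1 := fun r _ => by
    have : ‖w r‖ = θ * ((conorm φ l r)⁻¹ * conorm φ l r) := by
      rw [hw, norm_smul, Real.norm_eq_abs,
        abs_of_nonneg (mul_nonneg hθ (inv_nonneg.2 (conorm_nonneg l r))), mul_assoc]
      rfl
    rw [this]
    have h1 : (conorm φ l r)⁻¹ * conorm φ l r ≤ 1 := inv_mul_le_one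
    nlinarith
  refine ⟨_, ⟨w, hwc, hw1, fun i => rfl⟩, ?_⟩
  simp only [← intervalIntegral.integral_const_mul]
  rw [← intervalIntegral.integral_finsetSum fun i _ =>
    (h.intervalIntegrable_control ht hs hts hwc hw1 i).const_mul _, support,
    ← intervalIntegral.integral_const_mul]
  refine intervalIntegral.integral_congr fun r _ => ?_
  have h2 : ∑ i, (l i * φ i r) ^ 2 = conorm φ l r ^ 2 := by
    rw [conorm, EuclideanSpace.norm_sq_eq]
    simp [mul_pow]
  have h3 : ∑ i, l i * (w r i * φ i r) = θ * (conorm φ l r)⁻¹ * ∑ i, (l i * φ i r) ^ 2 := by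
    rw [Finset.mul_sum]
    refine Finset.sum_congr rfl fun i _ => ?_
    simp only [hw, PiLp.smul_apply, smul_eq_mul]
    ring
  show ∑ i, l i * (w r i * φ i r) = θ * conorm φ l r
  rw [h3, h2]
  rcases eq_or_ne (conorm φ l r) 0 with h0 | h0
  · simp [h0]
  · field_simp

/-- A closed convex set is determined by its support function: a functional separating `ρ` from the
set would violate the inequality for its coefficient vector `l`. -/
theorem mem_closure_reachable (ht : t ∈ halfOpenInterval a b) (hs : s ∈ halfOpenInterval a b)
    (hts : t ≤ s) {ρ : Fin m → ℝ} (hρ : ∀ l : Fin m → ℝ, ∑ i, l i * ρ i ≤ support φ l t s) :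
    ρ ∈ closure (reachable φ t s) := by
  by_contra hn
  obtain ⟨F, u, h1, h2⟩ := geometric_hahn_banach_closed_point
    (h.convex_reachable ht hs hts).closure isClosed_closure hn
  set l : Fin m → ℝ := fun i => F (Pi.single i 1) with hl
  have hF : ∀ ρ, F ρ = ∑ i, l i * ρ i := fun ρ => by
    have := F.toLinearMap.pi_apply_eq_sum_univ ρ
    simp only [ContinuousLinearMap.coe_coe] at this
    rw [this]
    refine Finset.sum_congr rfl fun i _ => ?_
    rw [smul_eq_mul, mul_comm, hl]
    congr 2
    ext j
    simp [Pi.single_apply, eq_comm]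
  have h3 : ∀ θ, 0 ≤ θ → θ < 1 → θ * support φ l t s < u := fun θ h0 hθ => by
    obtain ⟨ρ', hρ', e⟩ := h.exists_mem_reachable_sum_eq ht hs hts l h0 hθ
    rw [← e, ← hF]
    exact h1 ρ' (subset_closure hρ')
  have h4 : u < support φ l t s := h2.trans_le ((hF ρ).trans_le (hρ l))
  have hu : 0 < u := by simpa using h3 0 le_rfl one_pos
  have := h3 (u / support φ l t s) (div_nonneg hu.le (hu.trans h4).le)
    ((div_lt_one (hu.trans h4)).2 h4)
  rw [div_mul_cancel₀ _ (hu.trans h4).ne'] at this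
  exact lt_irrefl _ this

end IsSpeed

/-- Half of the margin makes up for reaching only the closure by duality, the other half for the
possible absence of shortest curves in the factors. -/
theorem Timelike.exists_isGoodPath (h : IsSpeed a b fun i r => (√(f i r))⁻¹)
    (hK : ∀ i, IsLengthSpace (K i)) (hJ : J ⊆ halfOpenInterval a b) (hJc : J.OrdConnected)
    {p q : Warped J K} (hpq : Timelike (fun i r => (√(f i r))⁻¹) p q) :
    ∃ c, IsGoodPath f p q c := by
  obtain ⟨hlt, ε, hε, hle⟩ := hpq
  have ht := hJ p.1.2
  have hs := hJ q.1.2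
  have hmem : (fun i => dist (p.2 i) (q.2 i) + ε) ∈
      closure (reachable (fun i r => (√(f i r))⁻¹) p.1 q.1) := by
    refine h.mem_closure_reachable ht hs hlt.le fun l => le_trans ?_ (hle l)
    rw [weightedDist, Finset.mul_sum, ← Finset.sum_add_distrib]
    refine Finset.sum_le_sum fun i _ => ?_
    rw [mul_comm ε, ← mul_add]
    exact mul_le_mul_of_nonneg_right (le_abs_self _) (add_nonneg dist_nonneg hε.le)
  obtain ⟨ρ, ⟨w, hw, hw1, hρ⟩, hρd⟩ := Metric.mem_closure_iff.1 hmem (ε / 2) (half_pos hε)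
  set L : Fin m → ℝ := fun i => dist (p.2 i) (q.2 i) + ε / 2 with hL
  have hL0 : ∀ i, 0 < L i := fun i => add_pos_of_nonneg_of_pos dist_nonneg (half_pos hε)
  have hLρ : ∀ i, L i ≤ ρ i := fun i => by
    have h1 := (dist_le_pi_dist _ _ i).trans_lt hρd
    rw [Real.dist_eq] at h1
    have := (abs_lt.1 h1).2
    simp only [hL]
    linarith
  choose γ hγ hγ0 hγ1 using fun i => (hK i).exists_lipschitz (x := p.2 i) (y := q.2 i) (L := L i)
    (by simp only [hL]; linarith)
  -- The position along `γ i`. The factor `L i / ρ i ≤ 1` makes it end exactly at `L i`. It need not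
  -- be monotone or stay in `[0; L i]`, because `γ i` is `1`-Lipschitz on all of `ℝ`.
  set A : Fin m → ℝ → ℝ := fun i u =>
    L i / ρ i * ∫ r in (p.1 : ℝ)..u, w r i * (√(f i r))⁻¹ with hA
  have hint := h.intervalIntegrable_control ht hs hlt.le hw hw1
  have hAc : ∀ i, ContinuousOn (A i) (Icc (p.1 : ℝ) q.1) := fun i => by
    have := intervalIntegral.continuousOn_primitive_interval' (hint i) left_mem_uIcc
    rw [uIcc_of_le hlt.le] at this
    exact continuousOn_const.mul this
  have hpJ : ∀ u, (projIcc (p.1 : ℝ) q.1 hlt.le u : ℝ) ∈ J := fun u =>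
    hJc.out p.1.2 q.1.2 (projIcc _ _ hlt.le u).2
  refine ⟨fun u => (⟨projIcc (p.1 : ℝ) q.1 hlt.le u, hpJ u⟩, fun i => γ i (A i u)), hlt,
    ?_, ?_, ?_, ?_, ?_⟩
  · refine ContinuousOn.prodMk (Continuous.continuousOn ?_) (continuousOn_pi.2 fun i => ?_)
    · exact (continuous_subtype_val.comp continuous_projIcc).subtype_mk _
    · exact (hγ i).continuous.comp_continuousOn (hAc i)
  · refine Prod.ext (Subtype.ext ?_) (funext fun i => ?_)
    · simp
    · show γ i (A i p.1) = p.2 i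
      simp only [hA, intervalIntegral.integral_same, mul_zero, hγ0]
  · refine Prod.ext (Subtype.ext ?_) (funext fun i => ?_)
    · simp
    · show γ i (A i q.1) = q.2 i
      simp only [hA, ← hρ, div_mul_cancel₀ _ ((hL0 i).trans_le (hLρ i)).ne', hγ1]
  · intro u hu
    simp [projIcc_of_mem hlt.le hu]
  · intro r hr
    have hrO := Ioo_subset_openInterval ht hs hr
    have hpos : ∀ i, 0 < √(f i r) := fun i => inv_pos.1 (h.pos i r hrO)
    -- The constants `kᵢ = |wᵢ(r)| + η` leave room for the variation of the control and of the
    -- speeds near `r`.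
    obtain ⟨η, hη1, hη⟩ : ∃ η : ℝ, ∑ i, (|w r i| + η) ^ 2 < 1 ∧ 0 < η := by
      have hc : Continuous fun η : ℝ => ∑ i, (|w r i| + η) ^ 2 := by fun_prop
      have h0 : ∑ i, (|w r i| + 0) ^ 2 < 1 := by
        have := hw1 r hr
        rw [EuclideanSpace.norm_eq, Real.sqrt_lt' one_pos, one_pow] at this
        simpa using this
      have hev : ∀ᶠ η in 𝓝[>] (0 : ℝ), ∑ i, (|w r i| + η) ^ 2 < 1 :=
        nhdsWithin_le_nhds (hc.tendsto 0 |>.eventually_lt_const h0)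
      exact (hev.and self_mem_nhdsWithin).exists
    have hev : ∀ᶠ r' in 𝓝 r, ∀ i,
        |w r' i * (√(f i r'))⁻¹| < (|w r i| + η) * (√(f i r))⁻¹ := by
      refine eventually_all.2 fun i => ?_
      have hct : ContinuousAt (fun r' => |w r' i * (√(f i r'))⁻¹|) r := by
        have h1 : ContinuousAt w r := hw.continuousAt (Ioo_mem_nhds hr.1 hr.2)
        have h2 : ContinuousAt (fun r => (√(f i r))⁻¹) r :=
          (h.continuousOn i).continuousAt (isOpen_openInterval.mem_nhds hrO)
        have h3 : ContinuousAt (fun r' => w r' i) r :=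
          (by fun_prop : Continuous fun x : EuclideanSpace ℝ (Fin m) => x i).continuousAt.comp h1
        exact (h3.mul h2).abs
      refine hct.eventually_lt_const ?_
      show |w r i * (√(f i r))⁻¹| < _
      rw [abs_mul, abs_of_pos (inv_pos.2 (hpos i))]
      exact mul_lt_mul_of_pos_right (by linarith) (inv_pos.2 (hpos i))
    obtain ⟨δ, hδ, hball⟩ := Metric.nhds_basis_closedBall.mem_iff.1
      (inter_mem (Ioo_mem_nhds hr.1 hr.2) hev)
    rw [Real.closedBall_eq_Icc] at hball
    refine ⟨Icc (r - δ) (r + δ), Icc_mem_nhds (by linarith) (by linarith),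
      fun i => ⟨|w r i| + η, by positivity⟩, ?_, fun i u hu v hv => ?_⟩
    · rw [← NNReal.coe_lt_coe]
      push_cast
      exact hη1
    have h1 : dist (γ i (A i u)) (γ i (A i v)) ≤ |A i u - A i v| := by
      simpa [Real.dist_eq] using (hγ i).dist_le_mul (A i u) (A i v)
    have hi : ∀ x ∈ Icc (p.1 : ℝ) q.1,
        IntervalIntegrable (fun r => w r i * (√(f i r))⁻¹) volume p.1 x := fun x hx =>
      (hint i).mono_set (by rw [uIcc_of_le hlt.le, uIcc_of_le hx.1]; exact Icc_subset_Icc_right hx.2)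
    have h2 : A i u - A i v = L i / ρ i * ∫ r in v..u, w r i * (√(f i r))⁻¹ := by
      simp only [hA]
      rw [← mul_sub, intervalIntegral.integral_interval_sub_left (hi u hu.2) (hi v hv.2)]
    have h3 := intervalIntegral.norm_integral_le_of_norm_le_const (a := v) (b := u)
      (f := fun r => w r i * (√(f i r))⁻¹) (C := (|w r i| + η) * (√(f i r))⁻¹)
      fun x hx => ((hball (uIcc_subset_Icc hv.1 hu.1 (uIoc_subset_uIcc hx))).2 i).le
    have h4 : |L i / ρ i| ≤ 1 := by
      rw [abs_of_nonneg (div_nonneg (hL0 i).le ((hL0 i).le.trans (hLρ i)))]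
      exact div_le_one_of_le₀ (hLρ i) ((hL0 i).le.trans (hLρ i))
    have h5 : |A i u - A i v| ≤ (|w r i| + η) * (√(f i r))⁻¹ * |u - v| := by
      rw [h2, abs_mul]
      exact (mul_le_of_le_one_left (abs_nonneg _) h4).trans h3
    refine (mul_le_mul_of_nonneg_left (h1.trans h5) (hpos i).le).trans_eq ?_
    show _ = (|w r i| + η) * |u - v|
    have := (hpos i).ne'
    field_simp

theorem goodChron_iff_timelike (h : IsSpeed a b fun i r => (√(f i r))⁻¹)
    (hK : ∀ i, IsLengthSpace (K i)) (hJ : J ⊆ halfOpenInterval a b) (hJc : J.OrdConnected)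
    {p q : Warped J K} :
    goodChron J K f p q ↔ Timelike (fun i r => (√(f i r))⁻¹) p q :=
  ⟨fun ⟨_, hc⟩ => hc.timelike h hJ, fun hpq => hpq.exists_isGoodPath h hK hJ hJc⟩

end GoodPathExistence

/-! ### Invariance of `τ₊` under isomorphisms of chronologies -/

section Transport

universe v

variable {Y Z : Type v} {R : Y → Y → Prop} {S : Z → Z → Prop}

theorem isClosed_tauPlus_iff {A : Set Y} :
    IsClosed[tauPlus R] A ↔ ∀ α : ℕ → Y, (∀ n, α n ∈ A) → limitOp R α ⊆ A := by
  rw [← @isOpen_compl_iff Y A (tauPlus R)]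
  show Aᶜᶜ ∈ {S : Set Y | ∀ a : ℕ → Y, (∀ n, a n ∈ S) → limitOp R a ⊆ S} ↔ _
  rw [compl_compl]
  rfl

variable (e : Y ≃ Z) (he : ∀ x y, R x y ↔ S (e x) (e y))
include he

theorem causalRel_equiv_iff (x y : Y) : CausalRel S (e x) (e y) ↔ CausalRel R x y := by
  simp only [CausalRel, subset_def, mem_ofPred_eq, he, e.surjective.forall]

theorem chronPast_image_equiv (A : Set Y) : chronPast S (e '' A) = e '' chronPast R A := by
  ext z
  obtain ⟨x, rfl⟩ := e.surjective z
  rw [e.injective.mem_set_image]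
  simp only [chronPast, mem_ofPred_eq, exists_mem_image, he]

theorem liminfPast_equiv (α : ℕ → Y) : liminfPast S (e ∘ α) = e '' liminfPast R α := by
  ext z
  obtain ⟨x, rfl⟩ := e.surjective z
  simp [liminfPast, jointCausalPast, causalRel_equiv_iff e he]

theorem limsupPast_equiv (α : ℕ → Y) : limsupPast S (e ∘ α) = e '' limsupPast R α := by
  ext z
  obtain ⟨x, rfl⟩ := e.surjective z
  simp [limsupPast, jointCausalPast, causalRel_equiv_iff e he]

theorem mem_limitOp_equiv_iff (α : ℕ → Y) (v : Y) :
    e v ∈ limitOp S (e ∘ α) ↔ v ∈ limitOp R α := by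
  have h1 : ({e v} : Set Z) = e '' {v} := image_singleton.symm
  simp only [limitOp, mem_ofPred_eq, liminfPast_equiv e he, limsupPast_equiv e he, h1,
    chronPast_image_equiv e he, e.injective.image_injective.eq_iff]

theorem isClosed_tauPlus_preimage_iff (A : Set Z) :
    IsClosed[tauPlus R] (e ⁻¹' A) ↔ IsClosed[tauPlus S] A := by
  rw [isClosed_tauPlus_iff, isClosed_tauPlus_iff]
  constructor
  · intro h α hα z hz
    obtain ⟨v, rfl⟩ := e.surjective z
    refine h (e.symm ∘ α) (fun n => by simpa using hα n) ((mem_limitOp_equiv_iff e he _ v).1 ?_)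
    rwa [← Function.comp_assoc, e.self_comp_symm, Function.id_comp]
  · exact fun h α hα v hv => h (e ∘ α) hα ((mem_limitOp_equiv_iff e he α v).2 hv)

theorem isHomeomorph_tauPlus_equiv : @IsHomeomorph Y Z (tauPlus R) (tauPlus S) e := by
  let := tauPlus R
  let := tauPlus S
  have hind : IsInducing e :=
    ⟨TopologicalSpace.ext_iff_isClosed.2 fun A => by
      rw [isClosed_induced_iff]
      constructor
      · intro hA
        refine ⟨e '' A, (isClosed_tauPlus_preimage_iff e he _).1 ?_, e.preimage_image A⟩
        rwa [e.preimage_image]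
      · rintro ⟨B, hB, rfl⟩
        exact (isClosed_tauPlus_preimage_iff e he _).2 hB⟩
  exact (isHomeomorph_iff_isEmbedding_surjective).2 ⟨⟨hind, e.injective⟩, e.surjective⟩

end Transport

/-! ### Directedness of indecomposable past sets -/

section IndecomposablePasts

variable {Y : Type*} {R : Y → Y → Prop}

theorem isPast_chronPast (htr : ∀ x y z, R x y → R y z → R x z)
    (hden : ∀ x y, R x y → ∃ z, R x z ∧ R z y) (A : Set Y) : IsPast R (chronPast R A) := by
  ext x
  constructor
  · rintro ⟨y, hy, hxy⟩
    obtain ⟨z, h1, h2⟩ := hden x y hxy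
    exact ⟨z, ⟨y, hy, h2⟩, h1⟩
  · rintro ⟨y, ⟨z, hz, hyz⟩, hxy⟩
    exact ⟨z, hz, htr x y z hxy hyz⟩

/-- Indecomposable past sets are directed. -/
theorem IsIndecomposablePast.exists_rel_rel (htr : ∀ x y z, R x y → R y z → R x z)
    (hden : ∀ x y, R x y → ∃ z, R x z ∧ R z y) {A : Set Y} (hA : IsIndecomposablePast R A)
    {x y : Y} (hx : x ∈ A) (hy : y ∈ A) : ∃ z ∈ A, R x z ∧ R y z := by
  obtain ⟨-, hp, hind⟩ := hA
  by_contra! hne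
  have hsub : ∀ B ⊆ A, chronPast R B ⊆ A := fun B hB => by
    rw [hp]
    exact chronPast_mono R hB
  -- Without a common successor of `x` and `y` in `A`, the first part misses `y`; the second part
  -- always misses `x`. Together they exhaust `A`.
  refine hind ⟨chronPast R {z ∈ A | R x z}, chronPast R {z ∈ A | ¬ R x z},
    isPast_chronPast htr hden _, isPast_chronPast htr hden _,
    (hsub _ (sep_subset _ _)).ssubset_of_ne ?_, (hsub _ (sep_subset _ _)).ssubset_of_ne ?_, ?_⟩
  · intro h
    obtain ⟨z, ⟨hz, hxz⟩, hyz⟩ := h.symm ▸ hy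
    exact hne z hz hxz hyz
  · intro h
    obtain ⟨z, ⟨hz, hxz⟩, hxz'⟩ := h.symm ▸ hx
    exact hxz hxz'
  · refine Subset.antisymm (fun w hw => ?_) (union_subset (hsub _ (sep_subset _ _))
      (hsub _ (sep_subset _ _)))
    obtain ⟨z, hz, hwz⟩ := hp ▸ hw
    by_cases hxz : R x z
    · exact Or.inl ⟨z, ⟨hz, hxz⟩, hwz⟩
    · exact Or.inr ⟨z, ⟨hz, hxz⟩, hwz⟩

end IndecomposablePasts

/-! ### The future completion and its topology -/

section Completion

open MeasureTheory Filter

universe v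

variable {m : ℕ} {a : EReal} {b : ℝ} {φ : Fin m → ℝ → ℝ}
  {K : Fin m → Type v} [∀ i, MetricSpace (K i)] {J J₁ J₂ : Set ℝ}

/-- The inclusion of `(a; b) × K` into `(a; b] × K`. -/
def incl (p : Warped (openInterval a b) K) : Warped (halfOpenInterval a b) K :=
  (⟨p.1, openInterval_subset_halfOpenInterval p.1.2⟩, p.2)

/-- The chronological past in `(a; b) × K` of a point of `(a; b] × K`. -/
def innerPast (φ : Fin m → ℝ → ℝ) (q : Warped (halfOpenInterval a b) K) :
    Set (Warped (openInterval a b) K) := {p | Timelike φ p q}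

namespace IsSpeed

variable (h : IsSpeed a b φ)
include h

theorem exists_innerPast_mem_nhds (q : Warped (halfOpenInterval a b) K)
    {U : Set (Warped (halfOpenInterval a b) K)} (hU : U ∈ 𝓝 q) :
    ∃ p ∈ innerPast φ q, incl p ∈ U :=
  h.exists_timelike_mem_nhds q hU

/-- The inner past of `p` accumulates at `p`, and the causal past of `q` is closed. -/
theorem causal_of_innerPast_subset (hJ : J ⊆ halfOpenInterval a b)
    {p : Warped (halfOpenInterval a b) K} {q : Warped J K}
    (hpq : ∀ r ∈ innerPast φ p, Timelike φ r q) : Causal φ p q := by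
  have hcl := h.isClosed_causal_left (K := K) Subset.rfl hJ q
  refine hcl.closure_subset (mem_closure_iff_nhds.2 fun U hU => ?_)
  obtain ⟨r, hr, hrU⟩ := h.exists_innerPast_mem_nhds p hU
  exact ⟨incl r, hrU, (hpq r hr).causal⟩

theorem innerPast_injective :
    Function.Injective (innerPast φ : Warped (halfOpenInterval a b) K → _) := fun _ _ hpq =>
  (h.causal_of_innerPast_subset Subset.rfl fun _ hr => hpq.subset hr).antisymm
    (h.causal_of_innerPast_subset Subset.rfl fun _ hr => hpq.symm.subset hr)

theorem exists_timelike_timelike (hJ : J ⊆ halfOpenInterval a b) {p : Warped J K}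
    {q : Warped (halfOpenInterval a b) K} (hpq : Timelike φ p q) :
    ∃ r : Warped (openInterval a b) K, Timelike φ p r ∧ Timelike φ r q := by
  obtain ⟨r, hr, hrU⟩ := h.exists_innerPast_mem_nhds q
    (h.eventually_timelike_right hJ Subset.rfl hpq)
  exact ⟨r, hrU, hr⟩

theorem isIndecomposablePast_innerPast (q : Warped (halfOpenInterval a b) K) :
    IsIndecomposablePast (fun p r : Warped (openInterval a b) K => Timelike φ p r)
      (innerPast φ q) := by
  have hO : openInterval a b ⊆ halfOpenInterval a b := openInterval_subset_halfOpenInterval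
  refine ⟨?_, ?_, ?_⟩
  · obtain ⟨p, hp, -⟩ := h.exists_innerPast_mem_nhds q univ_mem
    exact ⟨p, hp⟩
  · ext p
    constructor
    · intro hp
      obtain ⟨r, h1, h2⟩ := h.exists_timelike_timelike hO hp
      exact ⟨r, h2, h1⟩
    · rintro ⟨r, h2, h1⟩
      exact h.timelike_trans hO hO Subset.rfl h1 h2
  · rintro ⟨B, C, hB, hC, hBA, hCA, hBC⟩
    obtain ⟨x, hx, hxB⟩ := exists_of_ssubset hBA
    obtain ⟨y, hy, hyC⟩ := exists_of_ssubset hCA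
    -- By openness, a point `z` of the past close enough to `q` lies above both `x` and `y`, so
    -- whichever part contains `z` contains one of them.
    obtain ⟨z, hz, hxz, hyz⟩ := h.exists_innerPast_mem_nhds q
      ((h.eventually_timelike_right hO Subset.rfl hx).and
        (h.eventually_timelike_right hO Subset.rfl hy))
    rw [hBC] at hz
    rcases hz with hz | hz
    · rw [hB] at hxB
      exact hxB ⟨z, hz, hxz⟩
    · rw [hC] at hyC
      exact hyC ⟨z, hz, hyz⟩

/-- The unit vectors `l` isolate single coordinates. The bound depends on `p` and the horizon `T`
only; it yields both the Cauchy property and compactness below. -/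
theorem dist_le_integral (h₁ : J₁ ⊆ halfOpenInterval a b) (h₂ : J₂ ⊆ halfOpenInterval a b)
    {p : Warped J₁ K} {q : Warped J₂ K} (hpq : Causal φ p q) {T : ℝ}
    (hT : T ∈ halfOpenInterval a b) (hqT : (q.1 : ℝ) ≤ T) (i : Fin m) :
    dist (p.2 i) (q.2 i) ≤ ∫ r in (p.1 : ℝ)..T, φ i r := by
  have h1 := (hpq.2 (Pi.single i 1)).trans
    (h.support_le_sum _ (h₁ p.1.2) (h₂ q.1.2) hpq.1)
  rw [weightedDist, Finset.sum_eq_single i (fun j _ hj => by simp [hj]) (by simp),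
    Finset.sum_eq_single i (fun j _ hj => by simp [hj]) (by simp), Pi.single_eq_same, abs_one,
    one_mul, one_mul] at h1
  refine h1.trans ?_
  rw [← intervalIntegral.integral_add_adjacent_intervals
    (h.integrable i _ (h₁ p.1.2) _ (h₂ q.1.2)) (h.integrable i _ (h₂ q.1.2) _ hT)]
  exact le_add_of_nonneg_right (intervalIntegral.integral_nonneg hqT fun r _ => h.nonneg i r)

/-- Every indecomposable past set of `(a; b) × K` is the past of a point of `(a; b] × K`. -/
theorem exists_eq_innerPast [∀ i, CompleteSpace (K i)] {A : Set (Warped (openInterval a b) K)}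
    (hA : IsIndecomposablePast (fun p r : Warped (openInterval a b) K => Timelike φ p r) A) :
    ∃ q, innerPast φ q = A := by
  have hO : openInterval a b ⊆ halfOpenInterval a b := openInterval_subset_halfOpenInterval
  have hdir : ∀ x ∈ A, ∀ y ∈ A, ∃ z ∈ A, Timelike φ x z ∧ Timelike φ y z := fun x hx y hy =>
    hA.exists_rel_rel (R := fun p r : Warped (openInterval a b) K => Timelike φ p r) (fun x y z => h.timelike_trans hO hO hO)
      (fun x y hxy => h.exists_timelike_timelike hO (q := incl y) hxy) hx hy
  obtain ⟨⟨r₀, hr₀⟩, hpast, -⟩ := hA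
  -- Directedness of `A` makes the futures within `A` a filter basis; its limit will be the required
  -- point.
  set F : Filter (Warped (openInterval a b) K) := ⨅ r ∈ A, 𝓟 {z ∈ A | Timelike φ r z}
  have hbasis : F.HasBasis (fun r => r ∈ A) fun r => {z ∈ A | Timelike φ r z} := by
    refine hasBasis_biInf_principal (fun x hx y hy => ?_) ⟨r₀, hr₀⟩
    obtain ⟨z, hz, h1, h2⟩ := hdir x hx y hy
    exact ⟨z, hz, fun w hw => ⟨hw.1, h.timelike_trans hO hO hO h1 hw.2⟩,
      fun w hw => ⟨hw.1, h.timelike_trans hO hO hO h2 hw.2⟩⟩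
  have : F.NeBot := hbasis.neBot_iff.2 fun {r} hr => by
    obtain ⟨z, hz, h1, -⟩ := hdir r hr r hr
    exact ⟨z, hz, h1⟩
  have hev : ∀ r ∈ A, ∀ᶠ z in F, z ∈ A ∧ Timelike φ r z := fun r hr => hbasis.mem_of_mem hr
  set times : Set ℝ := (fun z : Warped (openInterval a b) K => (z.1 : ℝ)) '' A
  have hbdd : BddAbove times := ⟨b, by rintro _ ⟨z, -, rfl⟩; exact z.1.2.2.le⟩
  set T : ℝ := sSup times
  have hleT : ∀ z ∈ A, (z.1 : ℝ) ≤ T := fun z hz => le_csSup hbdd ⟨z, hz, rfl⟩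
  have hTH : T ∈ halfOpenInterval a b :=
    ⟨r₀.1.2.1.trans_le (EReal.coe_le_coe_iff.2 (hleT r₀ hr₀)),
      csSup_le ⟨_, r₀, hr₀, rfl⟩ (by rintro _ ⟨z, -, rfl⟩; exact z.1.2.2.le)⟩
  have htend : Tendsto (fun z : Warped (openInterval a b) K => (z.1 : ℝ)) F (𝓝 T) := by
    refine tendsto_order.2 ⟨fun c hc => ?_, fun c hc => ?_⟩
    · obtain ⟨_, ⟨r, hr, rfl⟩, hcr⟩ := exists_lt_of_lt_csSup (s := times) ⟨_, r₀, hr₀, rfl⟩ hc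
      exact (hev r hr).mono fun z hz => lt_trans hcr hz.2.1
    · exact (hev r₀ hr₀).mono fun z hz => (hleT z hz.1).trans_lt hc
  have htendH : Tendsto (fun z : Warped (openInterval a b) K => (z.1 : ℝ)) F
      (𝓝[halfOpenInterval a b] T) :=
    tendsto_nhdsWithin_iff.2 ⟨htend, Eventually.of_forall fun z => hO z.1.2⟩
  -- Points of `A` above `r` stay within `∫ φᵢ`, taken from the time of `r` to `T`, of the `i`-th
  -- coordinate of `r`. This is small once the time of `r` is close to `T`, even if `T = b`.
  have hcauchy : ∀ i, Cauchy (map (fun z : Warped (openInterval a b) K => z.2 i) F) := by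
    intro i
    refine Metric.cauchy_iff.2 ⟨inferInstance, fun ε hε => ?_⟩
    have hsmall : ∀ᶠ t in 𝓝[halfOpenInterval a b] T, -(ε / 2) < ∫ r in T..t, φ i r := by
      refine (continuousOn_integral_halfOpenInterval (h.integrable i) hTH T hTH).eventually_const_lt ?_
      show -(ε / 2) < ∫ r in T..T, φ i r
      rw [intervalIntegral.integral_same]
      linarith
    obtain ⟨r, hr, hrA, -⟩ := ((htendH.eventually hsmall).and (hev r₀ hr₀)).exists
    rw [intervalIntegral.integral_symm, neg_lt_neg_iff] at hr
    have hd : ∀ z ∈ A, Timelike φ r z → dist (r.2 i) (z.2 i) < ε / 2 := fun z hz hrz =>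
      (h.dist_le_integral hO hO hrz.causal hTH (hleT z hz) i).trans_lt hr
    refine ⟨_, image_mem_map (hev r hrA), ?_⟩
    rintro _ ⟨z, ⟨hz, hrz⟩, rfl⟩ _ ⟨z', ⟨hz', hrz'⟩, rfl⟩
    have h1 := dist_triangle_left (z.2 i) (z'.2 i) (r.2 i)
    linarith [hd z hz hrz, hd z' hz' hrz']
  choose x hx using fun i => CompleteSpace.complete (hcauchy i)
  set q : Warped (halfOpenInterval a b) K := (⟨T, hTH⟩, x)
  have hlim : Tendsto (incl : Warped (openInterval a b) K → _) F (𝓝 q) :=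
    Tendsto.prodMk_nhds (tendsto_subtype_rng.2 htend) (tendsto_pi_nhds.2 hx)
  -- Openness of the chronological future gives one inclusion, closedness of the causal future
  -- together with push-up the other.
  refine ⟨q, Subset.antisymm (fun r hr => ?_) fun r hr => ?_⟩
  · obtain ⟨z, h1, h2⟩ := ((hlim.eventually (h.eventually_timelike_right hO Subset.rfl hr)).and
      (hev r₀ hr₀)).exists
    rw [hpast]
    exact ⟨z, h2.1, h1⟩
  · obtain ⟨r', hr', hrr'⟩ := hpast.subset hr
    have : Causal φ r' q := (h.isClosed_causal_right hO Subset.rfl r').mem_of_tendsto hlim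
      ((hev r' hr').mono fun z hz => hz.2.causal)
    exact h.timelike_causal hO hO Subset.rfl hrr' this

theorem budicSachs_innerPast_iff (p q : Warped (halfOpenInterval a b) K) :
    (jointChronFuture (fun p r : Warped (openInterval a b) K => Timelike φ p r) (innerPast φ p) ∩
      innerPast φ q).Nonempty ↔ Timelike φ p q := by
  have hO : openInterval a b ⊆ halfOpenInterval a b := openInterval_subset_halfOpenInterval
  constructor
  · rintro ⟨z, hz, hzq⟩
    exact h.causal_timelike Subset.rfl hO Subset.rfl (h.causal_of_innerPast_subset hO hz) hzq
  · intro hpq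
    -- The witness is `p` itself: having a later point `q`, it has a time less than `b`.
    exact ⟨(⟨p.1, p.1.2.1, hpq.1.trans_le q.1.2.2⟩, p.2), fun r hr => hr, hpq⟩

theorem causalRel_iff_causal (p q : Warped (halfOpenInterval a b) K) :
    CausalRel (fun p q : Warped (halfOpenInterval a b) K => Timelike φ p q) p q ↔
      Causal φ p q := by
  constructor
  · exact fun hpq => h.causal_of_innerPast_subset Subset.rfl fun r hr =>
      hpq.2 (show incl r ∈ {z | Timelike φ z p} from hr)
  · exact fun hpq => ⟨fun z hz => h.causal_timelike Subset.rfl Subset.rfl Subset.rfl hpq hz,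
      fun z hz => h.timelike_causal Subset.rfl Subset.rfl Subset.rfl hz hpq⟩

theorem mem_limitOp_of_tendsto {α : ℕ → Warped (halfOpenInterval a b) K}
    {v : Warped (halfOpenInterval a b) K} (hα : Tendsto α atTop (𝓝 v)) :
    v ∈ limitOp (fun p q : Warped (halfOpenInterval a b) K => Timelike φ p q) α := by
  set R := fun p q : Warped (halfOpenInterval a b) K => Timelike φ p q
  have h1 : chronPast R {v} ⊆ chronPast R (liminfPast R α) := by
    rintro p ⟨_, rfl, hp⟩
    obtain ⟨r, hpr, hrv⟩ := h.exists_timelike_timelike Subset.rfl hp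
    obtain ⟨n, hn⟩ := eventually_atTop.1 (hα.eventually
      (h.eventually_timelike_right openInterval_subset_halfOpenInterval Subset.rfl hrv))
    refine ⟨incl r, mem_iUnion.2 ⟨n, ?_⟩, hpr⟩
    rintro _ ⟨k, hk, rfl⟩
    exact (h.causalRel_iff_causal _ _).2 (Timelike.causal (hn k hk) : Causal φ r (α k))
  have h2 := chronPast_mono R (liminfPast_subset_limsupPast R α)
  have h3 : chronPast R (limsupPast R α) ⊆ chronPast R {v} := by
    rintro p ⟨z, hz, hpz⟩
    obtain ⟨j, hj, hz⟩ := mem_iUnion₂.1 hz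
    have : Causal φ z v := (h.isClosed_causal_right Subset.rfl Subset.rfl z).mem_of_tendsto
      (hα.comp hj.tendsto_atTop)
      (Eventually.of_forall fun n => (h.causalRel_iff_causal _ _).1 (hz _ ⟨n, rfl⟩))
    exact ⟨v, rfl, h.timelike_causal Subset.rfl Subset.rfl Subset.rfl hpz this⟩
  exact ⟨h2.antisymm (h3.trans h1), h3.antisymm (h1.trans h2)⟩

/-- A tail of the sequence lies in the future of a single point `p`, which is relatively compact
because times are confined to `[p.1; b]` and the factors are proper. A subsequential limit `w`
belongs to `L₊` of the subsequence, as does `v`, so `v` and `w` have the same past and coincide. -/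
theorem exists_tendsto_subseq_of_mem_limitOp [∀ i, ProperSpace (K i)]
    {α : ℕ → Warped (halfOpenInterval a b) K} {v : Warped (halfOpenInterval a b) K}
    (hv : v ∈ limitOp (fun p q : Warped (halfOpenInterval a b) K => Timelike φ p q) α) :
    ∃ j : ℕ → ℕ, StrictMono j ∧ Tendsto (α ∘ j) atTop (𝓝 v) := by
  set R := fun p q : Warped (halfOpenInterval a b) K => Timelike φ p q
  have hO : openInterval a b ⊆ halfOpenInterval a b := openInterval_subset_halfOpenInterval
  obtain ⟨p, hp, -⟩ := h.exists_innerPast_mem_nhds v univ_mem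
  obtain ⟨z, hz, hpz⟩ : incl p ∈ chronPast R (liminfPast R α) := by
    rw [hv.1, hv.2]
    exact ⟨v, rfl, hp⟩
  obtain ⟨n, hn⟩ := mem_iUnion.1 hz
  have hpα : ∀ k, Causal φ p (α (n + k)) := fun k =>
    (h.timelike_causal hO Subset.rfl Subset.rfl hpz
      ((h.causalRel_iff_causal _ _).1 (hn _ ⟨n + k, Nat.le_add_right n k, rfl⟩))).causal
  have hC : IsCompact ({t : halfOpenInterval a b | (p.1 : ℝ) ≤ t} ×ˢ
      univ.pi fun i => Metric.closedBall (p.2 i) (∫ r in (p.1 : ℝ)..b, φ i r)) := by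
    refine IsCompact.prod (Subtype.isCompact_iff.2 ?_)
      (isCompact_univ_pi fun i => isCompact_closedBall _ _)
    convert isCompact_Icc (a := (p.1 : ℝ)) (b := b) using 1
    ext t
    constructor
    · rintro ⟨s, hs, rfl⟩
      exact ⟨hs, s.2.2⟩
    · exact fun ht => ⟨⟨t, ordConnected_halfOpenInterval.out (hO p.1.2) h.right_mem ht⟩, ht.1, rfl⟩
  obtain ⟨w, -, j, hj, hw⟩ := hC.tendsto_subseq (x := fun k => α (n + k)) fun k =>
    ⟨(hpα k).1, fun i _ => by
      rw [Metric.mem_closedBall, dist_comm]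
      exact h.dist_le_integral hO Subset.rfl (hpα k) h.right_mem (α (n + k)).1.2.2 i⟩
  have hj' : StrictMono fun k => n + j k := fun k k' hk => Nat.add_lt_add_left (hj hk) n
  have h1 := limitOp_subset_comp R α hj' hv
  have h2 : w ∈ limitOp R (α ∘ fun k => n + j k) := h.mem_limitOp_of_tendsto hw
  have h3 : chronPast R {v} = chronPast R {w} := h1.2.symm.trans h2.2
  have h4 : innerPast φ v = innerPast φ w := by
    ext r
    have := Set.ext_iff.1 h3 (incl r)
    simp only [chronPast, mem_ofPred_eq, mem_singleton_iff, exists_eq_left] at this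
    exact this
  rw [h.innerPast_injective h4]
  exact ⟨_, hj', hw⟩

/-- The product topology is metrizable, so its closed sets are the sequentially closed ones, and
these can be compared with `L₊`. -/
theorem tauPlus_eq [∀ i, ProperSpace (K i)] :
    tauPlus (fun p q : Warped (halfOpenInterval a b) K => Timelike φ p q) =
      instTopologicalSpaceProd := by
  refine TopologicalSpace.ext_iff_isClosed.2 fun A => ?_
  rw [isClosed_tauPlus_iff]
  constructor
  · exact fun hA => IsSeqClosed.isClosed fun α v hα hv => hA α hα (h.mem_limitOp_of_tendsto hv)
  · intro hA α hα v hv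
    obtain ⟨j, -, hj⟩ := h.exists_tendsto_subseq_of_mem_limitOp hv
    exact hA.mem_of_tendsto hj (Eventually.of_forall fun n => hα _)

theorem chronHomeomorphic [∀ i, ProperSpace (K i)] :
    ChronHomeomorphic
      (BudicSachs fun p q : Warped (openInterval a b) K => Timelike φ p q)
      (tauPlus (BudicSachs fun p q : Warped (openInterval a b) K => Timelike φ p q))
      (fun p q : Warped (halfOpenInterval a b) K => Timelike φ p q)
      instTopologicalSpaceProd := by
  set e : Warped (halfOpenInterval a b) K ≃
      IP fun p q : Warped (openInterval a b) K => Timelike φ p q :=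
    Equiv.ofBijective (fun q => ⟨innerPast φ q, h.isIndecomposablePast_innerPast q⟩)
      ⟨fun p q hpq => h.innerPast_injective (congrArg Subtype.val hpq), fun A => by
        obtain ⟨q, hq⟩ := h.exists_eq_innerPast A.2
        exact ⟨q, Subtype.ext hq⟩⟩ with he
  have hrel : ∀ x y, BudicSachs (fun p q : Warped (openInterval a b) K => Timelike φ p q) x y ↔
      Timelike φ (e.symm x) (e.symm y) := fun x y => by
    obtain ⟨p, rfl⟩ := e.surjective x
    obtain ⟨q, rfl⟩ := e.surjective y
    rw [e.symm_apply_apply, e.symm_apply_apply]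
    exact h.budicSachs_innerPast_iff p q
  refine ⟨e.symm, ?_, hrel⟩
  rw [← h.tauPlus_eq]
  exact isHomeomorph_tauPlus_equiv e.symm hrel

end IsSpeed

end Completion

end WarpedChron

/-! ### The main theorem -/

theorem mainTheorem8 {m : ℕ} (a : EReal) (b : ℝ) (hab : a < (b : EReal))
    (K : Fin m → Type*) [∀ i, MetricSpace (K i)] [∀ i, CompleteSpace (K i)]
    [∀ i, LocallyCompactSpace (K i)] (hK : ∀ i, WarpedChron.IsLengthSpace (K i))
    (f : Fin m → ℝ → ℝ)
    (hpos : ∀ i, ∀ t ∈ WarpedChron.openInterval a b, 0 < f i t)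
    (hC1 : ∀ i, ContDiffOn ℝ 1 (f i) (WarpedChron.openInterval a b))
    (hint : ∀ i, ∃ c ∈ WarpedChron.openInterval a b,
      MeasureTheory.IntegrableOn (fun t => f i t ^ (-(1 / 2) : ℝ)) (Set.Ioo c b)) :
    WarpedChron.ChronHomeomorphic
      (WarpedChron.BudicSachs (WarpedChron.goodChron (WarpedChron.openInterval a b) K f))
      (WarpedChron.tauPlus
        (WarpedChron.BudicSachs (WarpedChron.goodChron (WarpedChron.openInterval a b) K f)))
      (WarpedChron.goodChron (WarpedChron.halfOpenInterval a b) K f)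
      instTopologicalSpaceProd := by
  have h := WarpedChron.isSpeed_inv_sqrt hab hpos (fun i => (hC1 i).continuousOn) hint
  have : ∀ i, ProperSpace (K i) := fun i => (hK i).properSpace
  have hO : WarpedChron.goodChron (WarpedChron.openInterval a b) K f =
      fun p q => WarpedChron.Timelike (fun i r => (√(f i r))⁻¹) p q :=
    funext₂ fun p q => propext (WarpedChron.goodChron_iff_timelike h hK
      WarpedChron.openInterval_subset_halfOpenInterval WarpedChron.ordConnected_openInterval)
  have hH : WarpedChron.goodChron (WarpedChron.halfOpenInterval a b) K f =
      fun p q => WarpedChron.Timelike (fun i r => (√(f i r))⁻¹) p q :=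
    funext₂ fun p q => propext (WarpedChron.goodChron_iff_timelike h hK
      Subset.rfl WarpedChron.ordConnected_halfOpenInterval)
  rw [hO, hH]
  exact h.chronHomeomorphic
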